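/- Let $L>0$. For $V\in L^2=L^2(0,L)$ (real-valued) consider the operator $H_V\psi=-\psi''+V\psi$ with domain $W^{2,2}(0,L)\cap W^{1,2}_0(0,L)$, that is, with boundary conditions $\psi(0)=\psi(L)=0$, and let $E_k(V)$, $k=1,2,\dots$, be its eigenvalues in strictly increasing order. Let $k\ge 1$. For every $V\in L^2$ the $k$-th eigenvalue $E_k(V)$ exists (there is an eigenvalue of $H_V$ such that exactly $k$ eigenvalues of $H_V$ are less than or equal to it), the map $E_k(\cdot):L^2\to\mathbb R$ is continuously Fréchet differentiable, and for all $V,h\in L^2$ and every (real-valued, nonzero) eigenfunction $\phi_k(V)$ of $H_V$ for the eigenvalue $E_k(V)$, $$D_VE_k(V)(h)=\frac{1}{\|\phi_k(V)\|^2}\left\langle \phi_k(V)^2,h\right\rangle,$$ where $\langle\cdot,\cdot\rangle$ and $\|\cdot\|$ are the scalar product and the norm of $L^2(0,L)$. -/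

import Mathlib

open MeasureTheory Set

noncomputable section

/-- The real Hilbert space `L²(0, L)`. -/
abbrev L2Interval (L : ℝ) : Type :=
  Lp ℝ 2 (volume.restrict (Ioo (0 : ℝ) L))

/-- The first derivative of `φ` on `[0, L]` (one-sided at the end points). -/
def firstDeriv (L : ℝ) (φ : ℝ → ℝ) : ℝ → ℝ :=
  derivWithin φ (Icc 0 L)

/-- The second derivative of `φ` on `(0, L)`. It exists almost everywhere when the first
derivative is absolutely continuous. -/
def secondDeriv (L : ℝ) (φ : ℝ → ℝ) : ℝ → ℝ :=
  deriv (firstDeriv L φ)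

/-- The domain `W^{2,2}(0, L) ∩ W^{1,2}_0(0, L)` of the Dirichlet Schrödinger operator, in terms of
the `C¹[0, L]` representatives of its elements: the functions on `[0, L]` that vanish at both
end points and have an absolutely continuous first derivative and a second derivative in
`L²(0, L)`. The values of `φ` outside `[0, L]` play no role. -/
structure IsInDirichletDomain (L : ℝ) (φ : ℝ → ℝ) : Prop where
  differentiableOn : DifferentiableOn ℝ φ (Icc 0 L)
  absolutelyContinuous_firstDeriv : AbsolutelyContinuousOnInterval (firstDeriv L φ) 0 L
  memLp_secondDeriv : MemLp (secondDeriv L φ) 2 (volume.restrict (Ioo 0 L))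
  left_eq_zero : φ 0 = 0
  right_eq_zero : φ L = 0

/-- `φ` is an eigenfunction of `H_V = -d²/dx² + V` on `(0, L)` with zero boundary conditions, for
the eigenvalue `E`: a nonzero element of the domain with `-φ'' + V φ = E φ` in `L²(0, L)`. -/
structure IsDirichletEigenfunction (L : ℝ) (V : L2Interval L) (E : ℝ) (φ : ℝ → ℝ) : Prop where
  mem_domain : IsInDirichletDomain L φ
  exists_ne_zero : ∃ x ∈ Icc 0 L, φ x ≠ 0
  equation : ∀ᵐ x ∂(volume.restrict (Ioo 0 L)), -secondDeriv L φ x + V x * φ x = E * φ x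

/-- The set of Dirichlet eigenvalues of `-d²/dx² + V` on `(0, L)`. -/
def dirichletEigenvalues (L : ℝ) (V : L2Interval L) : Set ℝ :=
  {E | ∃ φ : ℝ → ℝ, IsDirichletEigenfunction L V E φ}

/-- `E` is the `k`-th eigenvalue (`k = 1, 2, …`) in increasing order: it is an eigenvalue, and
exactly `k` eigenvalues are less than or equal to it. At most one `E` has this property. -/
def IsKthDirichletEigenvalue (L : ℝ) (k : ℕ) (V : L2Interval L) (E : ℝ) : Prop :=
  E ∈ dirichletEigenvalues L V ∧ (dirichletEigenvalues L V ∩ Iic E).encard = k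

/-- The `k`-th Dirichlet eigenvalue `E_k(V)`, `k = 1, 2, …`, as a function of `V`: the only
element of the set below. -/
def dirichletEigenvalue (L : ℝ) (k : ℕ) (V : L2Interval L) : ℝ :=
  sInf {E | IsKthDirichletEigenvalue L k V E}

end

/-! ### Volterra integral operators with an `L²` kernel on `[0, L]`. -/

section Volterra

variable {L : ℝ}

/-! The proof is a shooting argument with the Prüfer angle. Let `y` solve `y'' = q y`, `y(0) = 0`,
`y'(0) = 1`. Every eigenfunction for `E` is a multiple of `y` with `q = V - E`, so `E` is an
eigenvalue iff `y(L) = 0`, that is, iff the angle `Θ(q)` of `y' + i y` at `L` is a multiple of `π`.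

Smoothness in `q`: the slope `p = y'` satisfies a Volterra equation `(1 - T_q) p = b + ∫ q a` with
`T_q` linear in `q`. Powers of `T_q` decay factorially, so `1 - T_q` is invertible for every `q`
(`isUnit_one_sub_doubleVolterra`), and inversion is smooth. The angle is an integral of expressions
in `y` and `y'`, hence also `C¹`.

Lagrange's identity at `L` gives `R dΘ(h) = -∫ y² h`, where `R = y'(L)² + y(L)²`
(`pruferRadiusSq_mul_fderiv_totalAngle`). So `Θ(V - E)` is strictly increasing in `E`. It is
positive, falls below `π` for very negative `E`, and takes arbitrarily large values; both bounds
come from Prüfer angles of `y' + i s y` with a scale `s` adapted to `E = ∓s²`. Hence `Θ(V - E) = kπ`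
has exactly one root for each `k ≥ 1`, and these roots are the eigenvalues in order. The implicit
function theorem makes the root `C¹` in `V`, and differentiating the equation gives the formula.

Pointwise identities are verified for continuous potentials and carried to `L²` by density and
continuity. -/

theorem intervalIntegrable_mul_of_L2 (q : L2Interval L) {f : ℝ → ℝ} (hf : Continuous f)
    {a b : ℝ} (ha : a ∈ Icc 0 L) (hb : b ∈ Icc 0 L) :
    IntervalIntegrable (fun t => q t * f t) volume a b := by
  have hq : IntegrableOn (fun t => q t) (Icc 0 L) volume := by
    rw [integrableOn_Icc_iff_integrableOn_Ioo]
    exact (Lp.memLp q).integrable (by norm_num)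
  have h : IntegrableOn (fun t => q t * f t) (Icc 0 L) volume :=
    hq.mul_continuousOn hf.continuousOn isCompact_Icc
  rw [intervalIntegrable_iff]
  exact h.mono_set (uIoc_subset_uIcc.trans (uIcc_subset_Icc ha hb))

theorem intervalIntegrable_of_L2 (q : L2Interval L)
    {a b : ℝ} (ha : a ∈ Icc 0 L) (hb : b ∈ Icc 0 L) :
    IntervalIntegrable (fun t => q t) volume a b := by
  simpa using intervalIntegrable_mul_of_L2 q (continuous_const (y := (1 : ℝ))) ha hb

theorem intervalIntegral_congr_of_ae_Ioo {f g : ℝ → ℝ}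
    (h : ∀ᵐ t ∂(volume.restrict (Ioo 0 L)), f t = g t) {a b : ℝ}
    (ha : a ∈ Icc 0 L) (hb : b ∈ Icc 0 L) :
    ∫ t in a..b, f t = ∫ t in a..b, g t := by
  apply intervalIntegral.integral_congr_ae
  rw [Measure.restrict_congr_set Ioo_ae_eq_Icc] at h
  rw [ae_restrict_iff' measurableSet_Icc] at h
  filter_upwards [h] with t ht hm
  exact ht (uIcc_subset_Icc ha hb (uIoc_subset_uIcc hm))

theorem exists_integral_abs_le_norm (L : ℝ) : ∃ C : ℝ, 0 ≤ C ∧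
    ∀ q : L2Interval L, ∫ t in Ioo 0 L, |q t| ≤ C * ‖q‖ := by
  refine ⟨((volume.restrict (Ioo 0 L)) univ ^ ((1 : ℝ) / 2)).toReal, ENNReal.toReal_nonneg,
    fun q => ?_⟩
  have h := eLpNorm_le_eLpNorm_mul_rpow_measure_univ (p := 1) (q := 2) (by norm_num)
    (Lp.memLp q).aestronglyMeasurable
  have h1 : ∫ t in Ioo 0 L, |q t| = (eLpNorm q 1 (volume.restrict (Ioo 0 L))).toReal := by
    rw [eLpNorm_one_eq_lintegral_enorm, ← integral_norm_eq_lintegral_enorm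
      (Lp.memLp q).aestronglyMeasurable]
    rfl
  rw [h1, Lp.norm_def, mul_comm, ← ENNReal.toReal_mul]
  norm_num at h
  refine ENNReal.toReal_mono (ENNReal.mul_ne_top (Lp.eLpNorm_ne_top q) ?_) (by simpa using h)
  exact ENNReal.rpow_ne_top_of_nonneg (by norm_num) (measure_ne_top _ _)

/-- The bound on the `L¹` norm by the `L²` norm on `(0, L)`. -/
noncomputable def normBound (L : ℝ) : ℝ := (exists_integral_abs_le_norm L).choose

theorem normBound_nonneg : 0 ≤ normBound L := (exists_integral_abs_le_norm L).choose_spec.1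

/-- The constant function `1` as an element of `L²(0, L)`. -/
noncomputable def oneL2 (L : ℝ) : L2Interval L := Lp.const 2 _ 1

theorem coeFn_oneL2 : ∀ᵐ t ∂(volume.restrict (Ioo 0 L)), oneL2 L t = 1 :=
  Lp.coeFn_const 2 (volume.restrict (Ioo 0 L)) (1 : ℝ)

variable [hL : Fact (0 < L)]

/-- The extension of a function on `[0, L]` to the real line by constants. -/
noncomputable def intervalExtend (y : C(Icc 0 L, ℝ)) : ℝ → ℝ :=
  IccExtend hL.out.le y

theorem continuous_intervalExtend (y : C(Icc 0 L, ℝ)) : Continuous (intervalExtend y) :=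
  y.continuous.Icc_extend'

theorem intervalExtend_coe (y : C(Icc 0 L, ℝ)) (x : Icc 0 L) : intervalExtend y x = y x :=
  IccExtend_val _ _ x

theorem intervalExtend_of_mem (y : C(Icc 0 L, ℝ)) {x : ℝ} (hx : x ∈ Icc 0 L) :
    intervalExtend y x = y ⟨x, hx⟩ :=
  IccExtend_of_mem _ _ hx

theorem abs_intervalExtend_le (y : C(Icc 0 L, ℝ)) (x : ℝ) : |intervalExtend y x| ≤ ‖y‖ :=
  y.norm_coe_le_norm _

theorem left_mem : (0 : ℝ) ∈ Icc 0 L := left_mem_Icc.2 hL.out.le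

theorem right_mem : L ∈ Icc 0 L := right_mem_Icc.2 hL.out.le

theorem integral_abs_le (q : L2Interval L) {x : ℝ} (hx : x ∈ Icc 0 L) :
    ∫ t in 0..x, |q t| ≤ normBound L * ‖q‖ := by
  refine le_trans ?_ ((exists_integral_abs_le_norm L).choose_spec.2 q)
  rw [← integral_Ioc_eq_integral_Ioo, ← intervalIntegral.integral_of_le hL.out.le]
  exact intervalIntegral.integral_mono_interval le_rfl hx.1 hx.2
    (Filter.Eventually.of_forall fun t => abs_nonneg _)
    (intervalIntegrable_of_L2 q left_mem right_mem).abs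

theorem abs_integral_mul_le (q : L2Interval L) {f : ℝ → ℝ} (hf : Continuous f) {x M : ℝ}
    (hx : x ∈ Icc 0 L) (hM : ∀ t ∈ Icc 0 x, |f t| ≤ M) :
    |∫ t in 0..x, q t * f t| ≤ normBound L * ‖q‖ * M := by
  have hM0 : 0 ≤ M := (abs_nonneg _).trans (hM 0 (left_mem_Icc.2 hx.1))
  calc |∫ t in 0..x, q t * f t| ≤ ∫ t in 0..x, |q t * f t| :=
        intervalIntegral.abs_integral_le_integral_abs hx.1
    _ ≤ ∫ t in 0..x, |q t| * M := by
        refine intervalIntegral.integral_mono_on hx.1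
          (intervalIntegrable_mul_of_L2 q hf left_mem hx).abs
          ((intervalIntegrable_of_L2 q left_mem hx).abs.mul_const M) fun t ht => ?_
        rw [abs_mul]
        exact mul_le_mul_of_nonneg_left (hM t ht) (abs_nonneg _)
    _ = (∫ t in 0..x, |q t|) * M := intervalIntegral.integral_mul_const _ _
    _ ≤ _ := mul_le_mul_of_nonneg_right (integral_abs_le q hx) hM0

/-- The function `x ↦ ∫₀ˣ q y` on `[0, L]`. -/
noncomputable def volterraFun (q : L2Interval L) (y : C(Icc 0 L, ℝ)) : C(Icc 0 L, ℝ) where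
  toFun x := ∫ t in 0..(x : ℝ), q t * intervalExtend y t
  continuous_toFun := by
    have h : IntegrableOn (fun t => q t * intervalExtend y t) (uIcc 0 L) volume := by
      have := intervalIntegrable_mul_of_L2 q (continuous_intervalExtend y) left_mem right_mem
      rw [intervalIntegrable_iff_integrableOn_Icc_of_le hL.out.le] at this
      rwa [uIcc_of_le hL.out.le]
    have h2 := intervalIntegral.continuousOn_primitive_interval h
    rw [uIcc_of_le hL.out.le] at h2
    exact continuousOn_iff_continuous_domRestrict.1 h2

theorem volterraFun_apply (q : L2Interval L) (y : C(Icc 0 L, ℝ)) (x : Icc 0 L) :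
    volterraFun q y x = ∫ t in 0..(x : ℝ), q t * intervalExtend y t := rfl

/-- The bounded bilinear map that takes `q` and `y` to the function `x ↦ ∫₀ˣ q y`. -/
noncomputable def volterra : L2Interval L →L[ℝ] C(Icc 0 L, ℝ) →L[ℝ] C(Icc 0 L, ℝ) :=
  LinearMap.mkContinuous₂ (LinearMap.mk₂ ℝ volterraFun
    (fun q r y => by
      ext x
      rw [ContinuousMap.add_apply, volterraFun_apply, volterraFun_apply, volterraFun_apply,
        ← intervalIntegral.integral_add
          (intervalIntegrable_mul_of_L2 q (continuous_intervalExtend y) left_mem x.2)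
          (intervalIntegrable_mul_of_L2 r (continuous_intervalExtend y) left_mem x.2)]
      apply intervalIntegral_congr_of_ae_Ioo _ left_mem x.2
      filter_upwards [Lp.coeFn_add q r] with t ht
      rw [ht, Pi.add_apply, add_mul])
    (fun c q y => by
      ext x
      rw [ContinuousMap.smul_apply, volterraFun_apply, volterraFun_apply, smul_eq_mul,
        ← intervalIntegral.integral_const_mul]
      apply intervalIntegral_congr_of_ae_Ioo _ left_mem x.2
      filter_upwards [Lp.coeFn_smul c q] with t ht
      rw [ht, Pi.smul_apply, smul_eq_mul, mul_assoc])
    (fun q y z => by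
      ext x
      rw [ContinuousMap.add_apply, volterraFun_apply, volterraFun_apply, volterraFun_apply,
        ← intervalIntegral.integral_add
          (intervalIntegrable_mul_of_L2 q (continuous_intervalExtend y) left_mem x.2)
          (intervalIntegrable_mul_of_L2 q (continuous_intervalExtend z) left_mem x.2)]
      congr 1
      ext t
      simp only [intervalExtend, IccExtend, Function.comp, ContinuousMap.add_apply, mul_add])
    (fun c q y => by
      ext x
      rw [ContinuousMap.smul_apply, volterraFun_apply, volterraFun_apply, smul_eq_mul,
        ← intervalIntegral.integral_const_mul]
      congr 1
      ext t
      simp only [intervalExtend, IccExtend, Function.comp, ContinuousMap.smul_apply, smul_eq_mul]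
      ring))
    (normBound L) (fun q y => by
      rw [ContinuousMap.norm_le _ (by have := normBound_nonneg (L := L); positivity)]
      exact fun x => abs_integral_mul_le q (continuous_intervalExtend y) x.2
        fun t _ => abs_intervalExtend_le y t)

theorem volterra_apply (q : L2Interval L) (y : C(Icc 0 L, ℝ)) (x : Icc 0 L) :
    volterra q y x = ∫ t in 0..(x : ℝ), q t * intervalExtend y t := rfl

theorem volterra_one_apply (y : C(Icc 0 L, ℝ)) (x : Icc 0 L) :
    volterra (oneL2 L) y x = ∫ t in 0..(x : ℝ), intervalExtend y t := by
  rw [volterra_apply]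
  apply intervalIntegral_congr_of_ae_Ioo _ left_mem x.2
  filter_upwards [coeFn_oneL2 (L := L)] with t ht
  rw [ht, one_mul]

/-- Causality: only values to the left of `x` enter. This is what lets pointwise bounds growing in
`x` be iterated. -/
theorem abs_volterra_apply_le (q : L2Interval L) (y : C(Icc 0 L, ℝ)) (x : Icc 0 L) {M : ℝ}
    (hM : ∀ t : Icc 0 L, t ≤ x → |y t| ≤ M) :
    |volterra q y x| ≤ normBound L * ‖q‖ * M := by
  refine abs_integral_mul_le q (continuous_intervalExtend y) x.2 fun t ht => ?_
  rw [intervalExtend_of_mem y ⟨ht.1, ht.2.trans x.2.2⟩]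
  exact hM _ ht.2

/-- The Volterra operator `p ↦ (x ↦ ∫₀ˣ q(t) ∫₀ᵗ p)` as a bounded linear function of `q`. -/
noncomputable def doubleVolterra :
    L2Interval L →L[ℝ] C(Icc 0 L, ℝ) →L[ℝ] C(Icc 0 L, ℝ) :=
  (((ContinuousLinearMap.compL ℝ C(Icc 0 L, ℝ) C(Icc 0 L, ℝ) C(Icc 0 L, ℝ)).flip
    (volterra (oneL2 L))).comp volterra)

theorem doubleVolterra_apply (q : L2Interval L) (y : C(Icc 0 L, ℝ)) :
    doubleVolterra q y = volterra q (volterra (oneL2 L) y) := rfl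

/-- The inner integration turns `xⁿ / n!` into `xⁿ⁺¹ / (n+1)!`; the outer one, against `q`, costs
only the factor `normBound L * ‖q‖` because that bound is monotone in `x`. -/
theorem abs_doubleVolterra_pow_apply_le (q : L2Interval L) (n : ℕ) (y : C(Icc 0 L, ℝ))
    (x : Icc 0 L) :
    |(doubleVolterra q ^ n) y x| ≤ ((normBound L * ‖q‖) ^ n * ‖y‖) * ((x : ℝ) ^ n / n.factorial) := by
  have hB := normBound_nonneg (L := L)
  induction n generalizing x with
  | zero => simpa using y.norm_coe_le_norm x
  | succ n ih =>
    rw [pow_succ', mul_apply_eq_comp, doubleVolterra_apply]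
    refine (abs_volterra_apply_le q _ x
      (M := ((normBound L * ‖q‖) ^ n * ‖y‖) * ((x : ℝ) ^ (n + 1) / (n + 1).factorial))
      fun t htx => ?_).trans (le_of_eq (by ring))
    have ht : (t : ℝ) ≤ x := htx
    rw [volterra_one_apply]
    calc |∫ u in 0..(t : ℝ), intervalExtend ((doubleVolterra q ^ n) y) u|
        ≤ ∫ u in 0..(t : ℝ), |intervalExtend ((doubleVolterra q ^ n) y) u| :=
          intervalIntegral.abs_integral_le_integral_abs t.2.1
      _ ≤ ∫ u in 0..(t : ℝ), ((normBound L * ‖q‖) ^ n * ‖y‖) * (u ^ n / n.factorial) := by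
          refine intervalIntegral.integral_mono_on t.2.1
            ((continuous_intervalExtend _).abs.intervalIntegrable _ _)
            (Continuous.intervalIntegrable (by fun_prop) _ _) fun u hu => ?_
          rw [intervalExtend_of_mem _ ⟨hu.1, hu.2.trans t.2.2⟩]
          exact ih _
      _ = ((normBound L * ‖q‖) ^ n * ‖y‖) * ((t : ℝ) ^ (n + 1) / (n + 1).factorial) := by
          rw [intervalIntegral.integral_const_mul, intervalIntegral.integral_div, integral_pow,
            Nat.factorial_succ]
          push_cast
          field_simp
          ring
      _ ≤ _ := by
          gcongr
          exact t.2.1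

/-- Some power `Tⁿ` has norm less than `1`, and `1 - T` is a commuting factor of the invertible `1 -
Tⁿ`. No smallness of `q` is needed. -/
theorem isUnit_one_sub_doubleVolterra (q : L2Interval L) : IsUnit (1 - doubleVolterra q) := by
  have hB := normBound_nonneg (L := L)
  have hn : ∃ n : ℕ, (normBound L * ‖q‖ * L) ^ n / n.factorial < 1 :=
    ((FloorSemiring.tendsto_pow_div_factorial_atTop (normBound L * ‖q‖ * L)).eventually
      (gt_mem_nhds one_pos)).exists
  obtain ⟨n, hn⟩ := hn
  have hL0 := hL.out
  have hnorm : ‖doubleVolterra q ^ n‖ < 1 := by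
    refine lt_of_le_of_lt (ContinuousLinearMap.opNorm_le_bound _ (by positivity) fun y => ?_) hn
    rw [ContinuousMap.norm_le _ (by positivity)]
    intro x
    refine (abs_doubleVolterra_pow_apply_le q n y x).trans ?_
    calc _ ≤ ((normBound L * ‖q‖) ^ n * ‖y‖) * (L ^ n / n.factorial) := by
          gcongr
          · exact x.2.1
          · exact x.2.2
      _ = _ := by rw [mul_pow _ L]; ring
  have h1 : IsUnit (1 - doubleVolterra q ^ n) := by
    exact isUnit_one_sub_of_norm_lt_one (x := doubleVolterra q ^ n) hnorm
  rw [← mul_neg_geom_sum] at h1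
  refine ((Commute.isUnit_mul_iff ?_).1 h1).1
  exact (mul_neg_geom_sum (doubleVolterra q) n).trans (geom_sum_mul_neg (doubleVolterra q) n).symm

end Volterra

/-- Used in two algebras: bounded operators, to solve the Volterra equation, and `C(Icc 0 L, ℝ)`, to
divide by the Prüfer radius. -/
theorem contDiff_ringInverse_comp {E R : Type*} [NormedAddCommGroup E] [NormedSpace ℝ E]
    [NormedRing R] [NormedAlgebra ℝ R] [CompleteSpace R] {f : E → R} (hf : ContDiff ℝ 1 f)
    (hu : ∀ x, IsUnit (f x)) : ContDiff ℝ 1 fun x => Ring.inverse (f x) := by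
  rw [contDiff_iff_contDiffAt]
  intro x
  obtain ⟨u, hx⟩ := hu x
  have h : ContDiffAt ℝ 1 Ring.inverse (f x) := by
    rw [← hx]
    exact contDiffAt_ringInverse ℝ u
  exact h.comp x hf.contDiffAt

/-! ### The initial value problem `y'' = q y`: smooth dependence on `q`, Lagrange and Wronskian
identities. -/

section InitialValueProblem

variable {L : ℝ}

/-- The class in `L²(0, L)` of a bounded continuous function. -/
noncomputable def toL2 (L : ℝ) (g : BoundedContinuousFunction ℝ ℝ) : L2Interval L :=
  BoundedContinuousFunction.toLp 2 (volume.restrict (Ioo 0 L)) ℝ g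

theorem denseRange_toL2 : DenseRange (toL2 L) :=
  BoundedContinuousFunction.toLp_denseRange ℝ _ ℝ (by norm_num)

theorem coeFn_toL2 (g : BoundedContinuousFunction ℝ ℝ) :
    ∀ᵐ t ∂(volume.restrict (Ioo 0 L)), toL2 L g t = g t :=
  BoundedContinuousFunction.coeFn_toLp (p := 2) (𝕜 := ℝ) (volume.restrict (Ioo 0 L)) g

variable [hL : Fact (0 < L)]

theorem volterra_toL2_apply (g : BoundedContinuousFunction ℝ ℝ) (y : C(Icc 0 L, ℝ)) (x : Icc 0 L) :
    volterra (toL2 L g) y x = ∫ t in 0..(x : ℝ), g t * intervalExtend y t := by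
  rw [volterra_apply]
  apply intervalIntegral_congr_of_ae_Ioo _ left_mem x.2
  filter_upwards [coeFn_toL2 (L := L) g] with t ht
  rw [ht]

/-- The first derivative of the solution of `y'' = q y`, `y(0) = a`, `y'(0) = b`. -/
noncomputable def initSlope (a b : ℝ) (q : L2Interval L) : C(Icc 0 L, ℝ) :=
  Ring.inverse (1 - doubleVolterra q)
    (ContinuousMap.const _ b + volterra q (ContinuousMap.const _ a))

/-- The solution of `y'' = q y`, `y(0) = a`, `y'(0) = b`. -/
noncomputable def initSolution (a b : ℝ) (q : L2Interval L) : C(Icc 0 L, ℝ) :=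
  ContinuousMap.const _ a + volterra (oneL2 L) (initSlope a b q)

theorem initSlope_eq (a b : ℝ) (q : L2Interval L) :
    initSlope a b q = ContinuousMap.const _ b + volterra q (initSolution a b q) := by
  have h := congrArg (fun T => T (ContinuousMap.const _ b + volterra q (ContinuousMap.const _ a)))
    (Ring.mul_inverse_cancel _ (isUnit_one_sub_doubleVolterra q))
  change (1 - doubleVolterra q) (initSlope a b q) = _ at h
  rw [sub_apply, doubleVolterra_apply, sub_eq_iff_eq_add] at h
  rw [initSolution, map_add, ← add_assoc]
  exact h

theorem eq_initSlope {a b : ℝ} {q : L2Interval L} {p : C(Icc 0 L, ℝ)}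
    (h : p = ContinuousMap.const _ b +
      volterra q (ContinuousMap.const _ a + volterra (oneL2 L) p)) : p = initSlope a b q := by
  have h1 : (1 - doubleVolterra q) p =
      ContinuousMap.const _ b + volterra q (ContinuousMap.const _ a) := by
    rw [sub_apply, doubleVolterra_apply, sub_eq_iff_eq_add, add_assoc, ← map_add]
    exact h
  rw [initSlope, ← h1]
  exact (congrArg (fun T => T p)
    (Ring.inverse_mul_cancel _ (isUnit_one_sub_doubleVolterra q))).symm

theorem contDiff_volterra_apply {f : L2Interval L → C(Icc 0 L, ℝ)} (hf : ContDiff ℝ 1 f) :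
    ContDiff ℝ 1 fun q => volterra q (f q) := by
  have h : ContDiff ℝ 1 fun q : L2Interval L => volterra q := by fun_prop
  exact h.clm_apply hf

theorem contDiff_initSlope (a b : ℝ) : ContDiff ℝ 1 (initSlope (L := L) a b) := by
  have h0 : ContDiff ℝ 1 fun q : L2Interval L => doubleVolterra q := by fun_prop
  have h1 : ContDiff ℝ 1 fun q : L2Interval L => 1 - doubleVolterra q := contDiff_const.sub h0
  have h2 : ContDiff ℝ 1 fun q : L2Interval L => Ring.inverse (1 - doubleVolterra q) := by
    exact contDiff_ringInverse_comp (R := C(Icc 0 L, ℝ) →L[ℝ] C(Icc 0 L, ℝ)) h1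
      isUnit_one_sub_doubleVolterra
  exact h2.clm_apply (contDiff_const.add (contDiff_volterra_apply contDiff_const))

theorem contDiff_initSolution (a b : ℝ) : ContDiff ℝ 1 (initSolution (L := L) a b) :=
  contDiff_const.add ((volterra (oneL2 L)).contDiff.comp (contDiff_initSlope a b))

theorem hasDerivWithinAt_intervalExtend {F : C(Icc 0 L, ℝ)} {f : ℝ → ℝ} {c : ℝ}
    (hf : Continuous f) (hF : ∀ x : Icc 0 L, F x = c + ∫ t in 0..(x : ℝ), f t) {x : ℝ}
    (hx : x ∈ Icc 0 L) : HasDerivWithinAt (intervalExtend F) (f x) (Icc 0 L) x := by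
  refine (((hf.integral_hasStrictDerivAt 0 x).hasDerivAt.const_add c).hasDerivWithinAt).congr
    (fun t ht => ?_) ?_
  · rw [intervalExtend_of_mem F ht, hF]
  · rw [intervalExtend_of_mem F hx, hF]

theorem hasDerivWithinAt_initSolution (a b : ℝ) (q : L2Interval L) {x : ℝ} (hx : x ∈ Icc 0 L) :
    HasDerivWithinAt (intervalExtend (initSolution a b q)) (intervalExtend (initSlope a b q) x)
      (Icc 0 L) x :=
  hasDerivWithinAt_intervalExtend (c := a) (continuous_intervalExtend _) (fun x => by
    rw [initSolution, ContinuousMap.add_apply, volterra_one_apply]; rfl) hx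

/-- For a continuous potential the slope is differentiable everywhere, so identities can be checked
by differentiation. -/
theorem hasDerivWithinAt_initSlope (a b : ℝ) (g : BoundedContinuousFunction ℝ ℝ) {x : ℝ}
    (hx : x ∈ Icc 0 L) :
    HasDerivWithinAt (intervalExtend (initSlope a b (toL2 L g)))
      (g x * intervalExtend (initSolution a b (toL2 L g)) x) (Icc 0 L) x :=
  hasDerivWithinAt_intervalExtend (c := b)
    (f := fun t => g t * intervalExtend (initSolution a b (toL2 L g)) t)
    (g.continuous.mul (continuous_intervalExtend _)) (fun x => by
      conv_lhs => rw [initSlope_eq]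
      rw [ContinuousMap.add_apply, volterra_toL2_apply]; rfl) hx

theorem initSolution_zero (a b : ℝ) (q : L2Interval L) :
    initSolution a b q ⟨0, left_mem⟩ = a := by
  rw [initSolution, ContinuousMap.add_apply, volterra_one_apply]
  simp

theorem initSlope_zero (a b : ℝ) (q : L2Interval L) :
    initSlope a b q ⟨0, left_mem⟩ = b := by
  rw [initSlope_eq, ContinuousMap.add_apply, volterra_apply]
  simp

theorem eq_left_of_hasDerivWithinAt_zero {f : ℝ → ℝ}
    (hf : ∀ x ∈ Icc 0 L, HasDerivWithinAt f 0 (Icc 0 L) x) {x : ℝ} (hx : x ∈ Icc 0 L) :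
    f x = f 0 :=
  constant_of_derivWithin_zero (fun x hx => (hf x hx).differentiableWithinAt)
    (fun x hx => (hf x (Ico_subset_Icc_self hx)).derivWithin
      (uniqueDiffOn_Icc hL.out x (Ico_subset_Icc_self hx))) x hx

/-- Lagrange's identity for the solutions of `y'' = q y` and `z'' = r z` with `y(0) = 0 = z(0)`. -/
theorem lagrange_identity (b d : ℝ) (q r : L2Interval L) :
    initSolution 0 b q * initSlope 0 d r - initSlope 0 b q * initSolution 0 d r =
      volterra (r - q) (initSolution 0 b q * initSolution 0 d r) := by
  have c1 : Continuous (initSolution (L := L) 0 b) := (contDiff_initSolution 0 b).continuous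
  have c2 : Continuous (initSolution (L := L) 0 d) := (contDiff_initSolution 0 d).continuous
  have c3 : Continuous (initSlope (L := L) 0 b) := (contDiff_initSlope 0 b).continuous
  have c4 : Continuous (initSlope (L := L) 0 d) := (contDiff_initSlope 0 d).continuous
  -- Both sides are continuous in `(q, r)`, so continuous potentials suffice; there the difference
  -- of the two sides has zero derivative.
  refine denseRange_toL2.induction_on₂ (isClosed_eq (by fun_prop) (by fun_prop)) (fun g h => ?_) q r
  ext x
  have key := eq_left_of_hasDerivWithinAt_zero (L := L)
    (f := fun x => intervalExtend (initSolution 0 b (toL2 L g)) x *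
        intervalExtend (initSlope 0 d (toL2 L h)) x -
      intervalExtend (initSlope 0 b (toL2 L g)) x *
        intervalExtend (initSolution 0 d (toL2 L h)) x -
      ∫ t in 0..x, (h t - g t) * (intervalExtend (initSolution 0 b (toL2 L g)) t *
        intervalExtend (initSolution 0 d (toL2 L h)) t)) (fun x hx => by
    have hI : Continuous fun t => (h t - g t) * (intervalExtend (initSolution 0 b (toL2 L g)) t *
        intervalExtend (initSolution 0 d (toL2 L h)) t) :=
      (h.continuous.sub g.continuous).mul
        ((continuous_intervalExtend _).mul (continuous_intervalExtend _))
    exact ((((hasDerivWithinAt_initSolution 0 b (toL2 L g) hx).fun_mul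
      (hasDerivWithinAt_initSlope 0 d h hx)).fun_sub
      ((hasDerivWithinAt_initSlope 0 b g hx).fun_mul
      (hasDerivWithinAt_initSolution 0 d (toL2 L h) hx))).fun_sub
      (hI.integral_hasStrictDerivAt 0 x).hasDerivAt.hasDerivWithinAt).congr_deriv (by ring)) x.2
  have hr : toL2 L h - toL2 L g = toL2 L (h - g) := by simp [toL2]
  simp only [intervalIntegral.integral_same, intervalExtend_of_mem _ (left_mem (L := L)),
    initSolution_zero, intervalExtend_coe] at key
  rw [hr, volterra_toL2_apply]
  simp only [ContinuousMap.sub_apply, ContinuousMap.mul_apply]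
  simp only [zero_mul, mul_zero, sub_zero] at key
  rw [sub_eq_zero.1 key]
  rfl

/-- Needed so that `y` and `y'` have no common zero, which keeps the Prüfer radius positive. -/
theorem wronskian_eq_one (q : L2Interval L) :
    initSolution 1 0 q * initSlope 0 1 q - initSlope 1 0 q * initSolution 0 1 q = 1 := by
  have c1 : Continuous (initSolution (L := L) 1 0) := (contDiff_initSolution 1 0).continuous
  have c2 : Continuous (initSolution (L := L) 0 1) := (contDiff_initSolution 0 1).continuous
  have c3 : Continuous (initSlope (L := L) 1 0) := (contDiff_initSlope 1 0).continuous
  have c4 : Continuous (initSlope (L := L) 0 1) := (contDiff_initSlope 0 1).continuous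
  refine denseRange_toL2.induction_on q (isClosed_eq (by fun_prop) (by fun_prop)) fun g => ?_
  ext x
  have key := eq_left_of_hasDerivWithinAt_zero (L := L)
    (f := fun x => intervalExtend (initSolution 1 0 (toL2 L g)) x *
        intervalExtend (initSlope 0 1 (toL2 L g)) x -
      intervalExtend (initSlope 1 0 (toL2 L g)) x *
        intervalExtend (initSolution 0 1 (toL2 L g)) x) (fun x hx => by
    exact (((hasDerivWithinAt_initSolution 1 0 (toL2 L g) hx).fun_mul
      (hasDerivWithinAt_initSlope 0 1 g hx)).fun_sub
      ((hasDerivWithinAt_initSlope 1 0 g hx).fun_mul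
      (hasDerivWithinAt_initSolution 0 1 (toL2 L g) hx))).congr_deriv (by ring)) x.2
  simp only [intervalExtend_of_mem _ (left_mem (L := L)),
    initSolution_zero, initSlope_zero, intervalExtend_coe] at key
  simpa using key

end InitialValueProblem

/-! ### Scaled Prüfer radius and angle. -/

section Prufer

variable {L : ℝ} [hL : Fact (0 < L)]

/-- The square of the radius in scaled Prüfer coordinates for the solution of `y'' = q y`,
`y(0) = 0`, `y'(0) = 1`. -/
noncomputable def pruferRadiusSq (s : ℝ) (q : L2Interval L) : C(Icc 0 L, ℝ) :=
  initSlope 0 1 q ^ 2 + s ^ 2 • initSolution 0 1 q ^ 2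

/-- The angle in scaled Prüfer coordinates for the solution of `y'' = q y`, `y(0) = 0`,
`y'(0) = 1`, that is, the continuous argument of `y' + i s y`. -/
noncomputable def pruferAngle (s : ℝ) (q : L2Interval L) : C(Icc 0 L, ℝ) :=
  s • (volterra (oneL2 L) (initSlope 0 1 q ^ 2 * Ring.inverse (pruferRadiusSq s q)) -
    volterra q (initSolution 0 1 q ^ 2 * Ring.inverse (pruferRadiusSq s q)))

theorem pruferRadiusSq_apply (s : ℝ) (q : L2Interval L) (x : Icc 0 L) :
    pruferRadiusSq s q x = initSlope 0 1 q x ^ 2 + s ^ 2 * initSolution 0 1 q x ^ 2 := rfl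

theorem pruferRadiusSq_pos {s : ℝ} (hs : 0 < s) (q : L2Interval L) (x : Icc 0 L) :
    0 < pruferRadiusSq s q x := by
  have h := DFunLike.congr_fun (wronskian_eq_one q) x
  simp only [ContinuousMap.sub_apply, ContinuousMap.mul_apply, ContinuousMap.one_apply] at h
  rw [pruferRadiusSq_apply]
  rcases eq_or_ne (initSlope 0 1 q x) 0 with h1 | h1
  · have : initSolution 0 1 q x ≠ 0 := fun h2 => by simp [h1, h2] at h
    positivity
  · positivity

theorem isUnit_pruferRadiusSq {s : ℝ} (hs : 0 < s) (q : L2Interval L) :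
    IsUnit (pruferRadiusSq s q) :=
  (ContinuousMap.isUnit_iff_forall_ne_zero _).2 fun x => (pruferRadiusSq_pos hs q x).ne'

theorem inverse_pruferRadiusSq_apply {s : ℝ} (hs : 0 < s) (q : L2Interval L) (x : Icc 0 L) :
    Ring.inverse (pruferRadiusSq s q) x = (pruferRadiusSq s q x)⁻¹ := by
  refine eq_inv_of_mul_eq_one_left ?_
  exact DFunLike.congr_fun (Ring.inverse_mul_cancel _ (isUnit_pruferRadiusSq hs q)) x

theorem contDiff_pruferRadiusSq (s : ℝ) : ContDiff ℝ 1 (pruferRadiusSq (L := L) s) :=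
  ((contDiff_initSlope 0 1).pow 2).add (((contDiff_initSolution 0 1).pow 2).const_smul _)

/-- Since the angle is defined by integrating its derivative, no branch of the argument has to be
chosen and only algebra operations and bounded linear maps are involved. -/
theorem contDiff_pruferAngle {s : ℝ} (hs : 0 < s) : ContDiff ℝ 1 (pruferAngle (L := L) s) := by
  have h1 := contDiff_ringInverse_comp (contDiff_pruferRadiusSq (L := L) s)
    (isUnit_pruferRadiusSq hs)
  have h2 : ContDiff ℝ 1 fun q : L2Interval L =>
      initSlope 0 1 q ^ 2 * Ring.inverse (pruferRadiusSq s q) :=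
    ((contDiff_initSlope 0 1).pow 2).mul h1
  have h3 : ContDiff ℝ 1 fun q : L2Interval L =>
      initSolution 0 1 q ^ 2 * Ring.inverse (pruferRadiusSq s q) :=
    ((contDiff_initSolution 0 1).pow 2).mul h1
  have h4 : ContDiff ℝ 1 fun q : L2Interval L =>
      volterra (oneL2 L) (initSlope 0 1 q ^ 2 * Ring.inverse (pruferRadiusSq s q)) := by
    fun_prop
  exact (h4.sub (contDiff_volterra_apply h3)).const_smul s

theorem pruferAngle_zero (s : ℝ) (q : L2Interval L) : pruferAngle s q ⟨0, left_mem⟩ = 0 := by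
  simp [pruferAngle, volterra_apply]

theorem hasDerivWithinAt_pruferAngle {s : ℝ} (hs : 0 < s) (g : BoundedContinuousFunction ℝ ℝ)
    {x : ℝ} (hx : x ∈ Icc 0 L) :
    HasDerivWithinAt (intervalExtend (pruferAngle s (toL2 L g)))
      (s * (intervalExtend (initSlope 0 1 (toL2 L g)) x ^ 2 -
        g x * intervalExtend (initSolution 0 1 (toL2 L g)) x ^ 2) /
          intervalExtend (pruferRadiusSq s (toL2 L g)) x) (Icc 0 L) x := by
  set q := toL2 L g with hq
  set F := initSlope 0 1 q ^ 2 * Ring.inverse (pruferRadiusSq s q) with hF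
  set G := initSolution 0 1 q ^ 2 * Ring.inverse (pruferRadiusSq s q) with hG
  have e1 := continuous_intervalExtend F
  have e2 : Continuous fun t => g t * intervalExtend G t :=
    g.continuous.mul (continuous_intervalExtend G)
  have h := hasDerivWithinAt_intervalExtend (F := pruferAngle s q) (c := 0)
    (f := fun t => s * (intervalExtend F t - g t * intervalExtend G t))
    (continuous_const.mul (e1.sub e2)) (fun x => ?_) hx
  · refine h.congr_deriv ?_
    simp only [hF, hG, intervalExtend_of_mem _ hx, ContinuousMap.mul_apply,
      ContinuousMap.pow_apply, inverse_pruferRadiusSq_apply hs]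
    ring
  · rw [zero_add, intervalIntegral.integral_const_mul, intervalIntegral.integral_sub
      (e1.intervalIntegrable _ _) (e2.intervalIntegrable _ _), ← volterra_one_apply,
      ← volterra_toL2_apply]
    rfl

end Prufer

/-! ### Polar representation and bounds on the Prüfer angle. -/

section PruferEstimates

variable {L : ℝ} [hL : Fact (0 < L)]

/-- Rotate `(y', s y)` back by the angle and divide by the radius: both components have zero
derivative (`k1`, `k2`), so the vector stays at its initial value `(1, 0)`. -/
theorem prufer_coordinates_toL2 {s : ℝ} (hs : 0 < s) (g : BoundedContinuousFunction ℝ ℝ)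
    (x : Icc 0 L) :
    initSlope 0 1 (toL2 L g) x =
      √(pruferRadiusSq s (toL2 L g) x) * Real.cos (pruferAngle s (toL2 L g) x) ∧
    s * initSolution 0 1 (toL2 L g) x =
      √(pruferRadiusSq s (toL2 L g) x) * Real.sin (pruferAngle s (toL2 L g) x) := by
  set q := toL2 L g with hq
  set P := intervalExtend (initSlope 0 1 q) with hP
  set Y := intervalExtend (initSolution 0 1 q) with hY
  set θ := intervalExtend (pruferAngle s q) with hθ
  set D := intervalExtend (pruferRadiusSq s q) with hD
  have hDpos : ∀ t ∈ Icc 0 L, 0 < D t := fun t ht => by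
    rw [hD, intervalExtend_of_mem _ ht]
    exact pruferRadiusSq_pos hs q _
  have hDeq : ∀ t, D t = P t ^ 2 + s ^ 2 * Y t ^ 2 := fun t => rfl
  have dP : ∀ t ∈ Icc 0 L, HasDerivWithinAt P (g t * Y t) (Icc 0 L) t :=
    fun t ht => hasDerivWithinAt_initSlope 0 1 g ht
  have dY : ∀ t ∈ Icc 0 L, HasDerivWithinAt Y (P t) (Icc 0 L) t :=
    fun t ht => hasDerivWithinAt_initSolution 0 1 q ht
  have dθ : ∀ t ∈ Icc 0 L,
      HasDerivWithinAt θ (s * (P t ^ 2 - g t * Y t ^ 2) / D t) (Icc 0 L) t :=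
    fun t ht => hasDerivWithinAt_pruferAngle hs g ht
  have dr : ∀ t ∈ Icc 0 L, HasDerivWithinAt (fun t => √(D t))
      ((P t * (g t * Y t) + s ^ 2 * (Y t * P t)) / √(D t)) (Icc 0 L) t := fun t ht => by
    have h1 : HasDerivWithinAt D (2 * P t * (g t * Y t) + s ^ 2 * (2 * Y t * P t))
        (Icc 0 L) t := by
      have := ((dP t ht).fun_pow 2).fun_add (((dY t ht).fun_pow 2).const_mul (s ^ 2))
      refine (this.congr_of_eventuallyEq (Filter.Eventually.of_forall hDeq)
        (hDeq t)).congr_deriv ?_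
      norm_num
    refine (h1.sqrt (hDpos t ht).ne').congr_deriv ?_
    have := Real.sqrt_pos.2 (hDpos t ht)
    field_simp
  have hsq : ∀ t ∈ Icc 0 L, √(D t) ^ 2 = D t := fun t ht => Real.sq_sqrt (hDpos t ht).le
  have k1 := eq_left_of_hasDerivWithinAt_zero (L := L)
    (f := fun t => (P t * Real.cos (θ t) + s * Y t * Real.sin (θ t)) / √(D t)) (fun t ht => by
      have hr := (Real.sqrt_pos.2 (hDpos t ht)).ne'
      have hD0 := (hDpos t ht).ne'
      have := ((((dP t ht).fun_mul (dθ t ht).cos).fun_add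
        (((dY t ht).const_mul s).fun_mul (dθ t ht).sin)).fun_div (dr t ht) hr)
      refine this.congr_deriv (div_eq_zero_iff.2 (Or.inl ?_))
      field_simp
      rw [hsq t ht, hDeq t]
      ring) x.2
  have k2 := eq_left_of_hasDerivWithinAt_zero (L := L)
    (f := fun t => (s * Y t * Real.cos (θ t) - P t * Real.sin (θ t)) / √(D t)) (fun t ht => by
      have hr := (Real.sqrt_pos.2 (hDpos t ht)).ne'
      have hD0 := (hDpos t ht).ne'
      have := (((((dY t ht).const_mul s).fun_mul (dθ t ht).cos).fun_sub
        ((dP t ht).fun_mul (dθ t ht).sin)).fun_div (dr t ht) hr)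
      refine this.congr_deriv (div_eq_zero_iff.2 (Or.inl ?_))
      field_simp
      rw [hsq t ht, hDeq t]
      ring) x.2
  have p0 : P 0 = 1 := by
    rw [hP, intervalExtend_of_mem _ (left_mem (L := L)), initSlope_zero]
  have y0 : Y 0 = 0 := by
    rw [hY, intervalExtend_of_mem _ (left_mem (L := L)), initSolution_zero]
  have θ0 : θ 0 = 0 := by
    rw [hθ, intervalExtend_of_mem _ (left_mem (L := L)), pruferAngle_zero]
  have hr := (Real.sqrt_pos.2 (hDpos x x.2)).ne'
  simp only [hDeq 0, p0, y0, θ0] at k1 k2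
  norm_num at k1 k2
  rw [div_eq_one_iff_eq hr] at k1
  have k2' : s * Y x * Real.cos (θ x) - P x * Real.sin (θ x) = 0 := k2.resolve_right hr
  have hsc := Real.sin_sq_add_cos_sq (θ x)
  have e1 : P x = √(D x) * Real.cos (θ x) := by
    linear_combination (-P x) * hsc + Real.cos (θ x) * k1 - Real.sin (θ x) * k2'
  have e2 : s * Y x = √(D x) * Real.sin (θ x) := by
    linear_combination (-s * Y x) * hsc + Real.sin (θ x) * k1 + Real.cos (θ x) * k2'
  simpa only [hP, hY, hθ, hD, intervalExtend_coe] using And.intro e1 e2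

theorem continuous_initSlope_apply (x : Icc 0 L) :
    Continuous fun q : L2Interval L => initSlope 0 1 q x :=
  (continuous_eval_const x).comp (contDiff_initSlope 0 1).continuous

theorem continuous_initSolution_apply (x : Icc 0 L) :
    Continuous fun q : L2Interval L => initSolution 0 1 q x :=
  (continuous_eval_const x).comp (contDiff_initSolution 0 1).continuous

theorem continuous_pruferRadiusSq_apply (s : ℝ) (x : Icc 0 L) :
    Continuous fun q : L2Interval L => pruferRadiusSq s q x :=
  (continuous_eval_const x).comp (contDiff_pruferRadiusSq s).continuous

theorem continuous_pruferAngle_apply {s : ℝ} (hs : 0 < s) (x : Icc 0 L) :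
    Continuous fun q : L2Interval L => pruferAngle s q x :=
  (continuous_eval_const x).comp (contDiff_pruferAngle hs).continuous

theorem initSlope_eq_mul_cos {s : ℝ} (hs : 0 < s) (q : L2Interval L) (x : Icc 0 L) :
    initSlope 0 1 q x = √(pruferRadiusSq s q x) * Real.cos (pruferAngle s q x) :=
  denseRange_toL2.induction_on q
    (isClosed_eq (continuous_initSlope_apply x) ((continuous_pruferRadiusSq_apply s x).sqrt.mul
      (Real.continuous_cos.comp (continuous_pruferAngle_apply hs x))))
    fun g => (prufer_coordinates_toL2 hs g x).1

theorem mul_initSolution_eq_mul_sin {s : ℝ} (hs : 0 < s) (q : L2Interval L) (x : Icc 0 L) :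
    s * initSolution 0 1 q x = √(pruferRadiusSq s q x) * Real.sin (pruferAngle s q x) :=
  denseRange_toL2.induction_on q
    (isClosed_eq ((continuous_initSolution_apply x).const_mul s)
      ((continuous_pruferRadiusSq_apply s x).sqrt.mul
      (Real.continuous_sin.comp (continuous_pruferAngle_apply hs x))))
    fun g => (prufer_coordinates_toL2 hs g x).2

theorem initSolution_eq_zero_iff_sin {s : ℝ} (hs : 0 < s) (q : L2Interval L) (x : Icc 0 L) :
    initSolution 0 1 q x = 0 ↔ Real.sin (pruferAngle s q x) = 0 := by
  have h := mul_initSolution_eq_mul_sin hs q x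
  have hr := (Real.sqrt_pos.2 (pruferRadiusSq_pos hs q x)).ne'
  constructor
  · intro h1
    rw [h1, mul_zero] at h
    exact (mul_eq_zero.1 h.symm).resolve_left hr
  · intro h1
    rw [h1, mul_zero] at h
    exact (mul_eq_zero.1 h).resolve_left hs.ne'

theorem HasDerivWithinAt.Ici_of_Icc {f : ℝ → ℝ} {f' a b x : ℝ}
    (h : HasDerivWithinAt f f' (Icc a b) x) (hx : x ∈ Ico a b) :
    HasDerivWithinAt f f' (Ici x) x :=
  h.mono_of_mem_nhdsWithin (Filter.mem_of_superset (Icc_mem_nhdsGE hx.2)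
    (Icc_subset_Icc_left hx.1))

/-- Where the angle is `0`, `y` vanishes and the angle has derivative `s > 0`, so it cannot cross
`0` downwards. -/
theorem pruferAngle_nonneg {s : ℝ} (hs : 0 < s) (q : L2Interval L) (x : Icc 0 L) :
    0 ≤ pruferAngle s q x := by
  refine denseRange_toL2.induction_on q
    (isClosed_le continuous_const (continuous_pruferAngle_apply hs x)) fun g => ?_
  have h := image_le_of_deriv_right_lt_deriv_boundary' (a := 0) (b := L)
    (f := fun t => -intervalExtend (pruferAngle s (toL2 L g)) t) (B := fun _ => 0)
    (B' := fun _ => 0)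
    (continuous_intervalExtend _).neg.continuousOn
    (fun t ht => ((hasDerivWithinAt_pruferAngle hs g (Ico_subset_Icc_self ht)).Ici_of_Icc ht).fun_neg)
    (by rw [intervalExtend_of_mem _ (left_mem (L := L)), pruferAngle_zero, neg_zero])
    continuousOn_const (fun t _ => hasDerivWithinAt_const _ _ _) (fun t ht hz => ?_) x.2
  · rw [intervalExtend_coe] at h
    linarith
  · have ht' := Ico_subset_Icc_self ht
    simp only [intervalExtend_of_mem _ ht', neg_eq_zero] at hz ⊢
    have hy : initSolution 0 1 (toL2 L g) ⟨t, ht'⟩ = 0 :=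
      (initSolution_eq_zero_iff_sin hs _ _).2 (by rw [hz, Real.sin_zero])
    have hR := pruferRadiusSq_pos hs (toL2 L g) ⟨t, ht'⟩
    have hR2 := pruferRadiusSq_apply s (toL2 L g) ⟨t, ht'⟩
    rw [hy] at hR2 ⊢
    norm_num at hR2 ⊢
    rw [← hR2]
    positivity

/-- For the potential `g + s²` the angle obeys `θ' = s cos 2θ - (g / s) sin² θ`. On `[π/4, 3π/4]`
the first term is nonpositive, so `θ' ≤ |g| / s`, and a barrier starting at `π/4` with a slightly
larger slope is never crossed. -/
theorem pruferAngle_add_le_toL2 {s : ℝ} (hs : 0 < s) (g : BoundedContinuousFunction ℝ ℝ)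
    (hg : normBound L * ‖toL2 L g‖ / s < Real.pi / 2) (x : Icc 0 L) :
    pruferAngle s (toL2 L g + s ^ 2 • oneL2 L) x ≤
      Real.pi / 4 + normBound L * ‖toL2 L g‖ / s := by
  have hB := normBound_nonneg (L := L)
  set h := g + BoundedContinuousFunction.const ℝ (s ^ 2) with hh
  have hq : toL2 L g + s ^ 2 • oneL2 L = toL2 L h := by
    rw [hh, toL2, toL2, map_add]
    congr 1
    refine Lp.ext ?_
    filter_upwards [Lp.coeFn_smul (s ^ 2) (oneL2 L), coeFn_oneL2 (L := L),
      coeFn_toL2 (L := L) (BoundedContinuousFunction.const ℝ (s ^ 2))] with t h1 h2 h3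
    rw [h1, Pi.smul_apply, h2, smul_eq_mul, mul_one]
    exact h3.symm
  rw [hq]
  have habs : ∀ t ∈ Icc 0 L, ∫ u in 0..t, |g u| ≤ normBound L * ‖toL2 L g‖ := fun t ht => by
    refine le_trans (le_of_eq ?_) (integral_abs_le (toL2 L g) ht)
    refine intervalIntegral_congr_of_ae_Ioo ?_ left_mem ht
    filter_upwards [coeFn_toL2 (L := L) g] with u hu
    rw [hu]
  refine le_of_forall_pos_le_add fun ε hε => ?_
  -- The tilt `ε' / L` makes the barrier inequality strict; the minimum keeps the barrier at or
  -- below `3π/4`.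
  set ε' := min ε ((Real.pi / 2 - normBound L * ‖toL2 L g‖ / s)) with hε'
  have hε'0 : 0 < ε' := lt_min hε (by linarith)
  have hL0 := hL.out
  set B : ℝ → ℝ := fun t => Real.pi / 4 + (∫ u in 0..t, |g u|) / s + ε' / L * t with hBdef
  have dB : ∀ t, HasDerivAt B (|g t| / s + ε' / L) t := fun t => by
    have h1 := ((g.continuous.abs.integral_hasStrictDerivAt 0 t).hasDerivAt.div_const s).const_add
      (Real.pi / 4)
    simpa using h1.fun_add ((hasDerivAt_id t).const_mul (ε' / L))
  have hlin : ∀ t ∈ Icc 0 L, 0 ≤ ε' / L * t ∧ ε' / L * t ≤ ε' := fun t ht =>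
    ⟨mul_nonneg (by positivity) ht.1, by
      calc ε' / L * t ≤ ε' / L * L := by gcongr; exact ht.2
        _ = ε' := by field_simp⟩
  have hBle : ∀ t ∈ Icc 0 L, B t ≤ Real.pi / 4 + normBound L * ‖toL2 L g‖ / s + ε' :=
    fun t ht => by
      have := (hlin t ht).2
      have h2 : (∫ u in 0..t, |g u|) / s ≤ normBound L * ‖toL2 L g‖ / s := by
        gcongr
        exact habs t ht
      simp only [hBdef]
      linarith
  have hBge : ∀ t ∈ Icc 0 L, Real.pi / 4 ≤ B t := fun t ht => by
    have := (hlin t ht).1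
    have h2 : 0 ≤ (∫ u in 0..t, |g u|) / s :=
      div_nonneg (intervalIntegral.integral_nonneg ht.1 fun _ _ => abs_nonneg _) hs.le
    simp only [hBdef]
    linarith
  have key := image_le_of_deriv_right_lt_deriv_boundary (a := 0) (b := L)
    (f := intervalExtend (pruferAngle s (toL2 L h))) (B := B)
    (continuous_intervalExtend _).continuousOn
    (fun t ht => (hasDerivWithinAt_pruferAngle hs h (Ico_subset_Icc_self ht)).Ici_of_Icc ht)
    (by
      rw [intervalExtend_of_mem _ (left_mem (L := L)), pruferAngle_zero]
      exact le_trans (by positivity) (hBge 0 left_mem))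
    dB (fun t ht hz => ?_) x.2
  · rw [intervalExtend_coe] at key
    have := hBle x x.2
    have := min_le_left ε ((Real.pi / 2 - normBound L * ‖toL2 L g‖ / s))
    linarith
  · have ht' := Ico_subset_Icc_self ht
    have h1 := hBle t ht'
    have h2 := hBge t ht'
    have h3 := min_le_right ε ((Real.pi / 2 - normBound L * ‖toL2 L g‖ / s))
    rw [← hz] at h1 h2
    simp only [intervalExtend_of_mem _ ht'] at h1 h2 ⊢
    have hD := pruferRadiusSq_pos hs (toL2 L h) ⟨t, ht'⟩
    have ec := initSlope_eq_mul_cos hs (toL2 L h) ⟨t, ht'⟩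
    have es := mul_initSolution_eq_mul_sin hs (toL2 L h) ⟨t, ht'⟩
    set D := pruferRadiusSq s (toL2 L h) ⟨t, ht'⟩
    set θ := pruferAngle s (toL2 L h) ⟨t, ht'⟩
    have es' : initSolution 0 1 (toL2 L h) ⟨t, ht'⟩ = √D * Real.sin θ / s := by
      rw [← es]
      field_simp
    have hcos : Real.cos (2 * θ) ≤ 0 :=
      Real.cos_nonpos_of_pi_div_two_le_of_le (by linarith) (by linarith)
    rw [Real.cos_two_mul'] at hcos
    have hsq : √D ^ 2 = D := Real.sq_sqrt hD.le
    have hht : h t = g t + s ^ 2 := rfl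
    have : s * (initSlope 0 1 (toL2 L h) ⟨t, ht'⟩ ^ 2 -
        h t * initSolution 0 1 (toL2 L h) ⟨t, ht'⟩ ^ 2) / D =
        s * (Real.cos θ ^ 2 - Real.sin θ ^ 2) + (-g t) * Real.sin θ ^ 2 / s := by
      rw [ec, es', hht]
      field_simp
      rw [hsq]
      ring
    rw [this]
    have h4 : s * (Real.cos θ ^ 2 - Real.sin θ ^ 2) ≤ 0 :=
      mul_nonpos_of_nonneg_of_nonpos hs.le hcos
    have h5 : (-g t) * Real.sin θ ^ 2 / s ≤ |g t| / s := by
      gcongr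
      calc (-g t) * Real.sin θ ^ 2 ≤ |g t| * Real.sin θ ^ 2 := by
            gcongr
            exact neg_le_abs _
        _ ≤ |g t| * 1 := by
            gcongr
            exact Real.sin_sq_le_one θ
        _ = |g t| := mul_one _
    have h6 : 0 < ε' / L := by positivity
    linarith

theorem pruferAngle_add_le {s : ℝ} (hs : 0 < s) (V : L2Interval L)
    (hV : normBound L * ‖V‖ / s < Real.pi / 2) (x : Icc 0 L) :
    pruferAngle s (V + s ^ 2 • oneL2 L) x ≤ Real.pi / 4 + normBound L * ‖V‖ / s := by
  -- Density needs a closed condition; an implication with a strict hypothesis becomes a union of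
  -- two closed sets.
  have h : ∀ V : L2Interval L, Real.pi / 2 ≤ normBound L * ‖V‖ / s ∨
      pruferAngle s (V + s ^ 2 • oneL2 L) x ≤ Real.pi / 4 + normBound L * ‖V‖ / s := by
    intro V
    have c1 : Continuous fun V : L2Interval L => normBound L * ‖V‖ / s := by fun_prop
    have c2 : Continuous fun V : L2Interval L => pruferAngle s (V + s ^ 2 • oneL2 L) x :=
      (continuous_pruferAngle_apply hs x).comp (continuous_id.add continuous_const)
    refine denseRange_toL2.induction_on V ((isClosed_le continuous_const c1).union
      (isClosed_le c2 (continuous_const.add c1))) fun g => ?_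
    rcases le_or_gt (Real.pi / 2) (normBound L * ‖toL2 L g‖ / s) with hg | hg
    · exact Or.inl hg
    · exact Or.inr (pruferAngle_add_le_toL2 hs g hg x)
  exact (h V).resolve_left (not_le.2 hV)

/-- With potential `V - s²` and `R = y'² + s² y²`, the integrand of the angle is `s - s V y² / R`,
and `y² / R ≤ 1 / s²`. The integral definition gives this for `L²` potentials directly. -/
theorem le_pruferAngle_sub {s : ℝ} (hs : 0 < s) (V : L2Interval L) (x : Icc 0 L) :
    s * x - normBound L * ‖V‖ / s ≤ pruferAngle s (V - s ^ 2 • oneL2 L) x := by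
  set q := V - s ^ 2 • oneL2 L with hq
  set G := initSolution 0 1 q ^ 2 * Ring.inverse (pruferRadiusSq s q) with hG
  have h1 : pruferAngle s q = s • (volterra (oneL2 L) 1 - volterra V G) := by
    have hR : (1 : C(Icc 0 L, ℝ)) =
        initSlope 0 1 q ^ 2 * Ring.inverse (pruferRadiusSq s q) + s ^ 2 • G := by
      rw [hG, ← Ring.mul_inverse_cancel _ (isUnit_pruferRadiusSq hs q), ← smul_mul_assoc,
        ← add_mul]
      rfl
    rw [pruferAngle, hR, map_add, map_smul]
    conv_lhs => rw [← hG]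
    have : volterra q G = volterra V G - s ^ 2 • volterra (oneL2 L) G := by
      rw [hq, map_sub, map_smul]
      rfl
    rw [this]
    congr 1
    abel
  have h2 : |volterra V G x| ≤ normBound L * ‖V‖ * (1 / s ^ 2) := by
    refine abs_volterra_apply_le V G x fun t _ => ?_
    have hD := pruferRadiusSq_pos hs q t
    rw [hG, ContinuousMap.mul_apply, ContinuousMap.pow_apply, inverse_pruferRadiusSq_apply hs,
      abs_of_nonneg (by positivity), ← div_eq_mul_inv, div_le_div_iff₀ hD (by positivity),
      pruferRadiusSq_apply]
    nlinarith [sq_nonneg (initSlope 0 1 q t)]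
  have h3 : volterra (oneL2 L) 1 x = x := by
    rw [volterra_one_apply]
    have : ∀ t, intervalExtend (1 : C(Icc 0 L, ℝ)) t = 1 := fun t => rfl
    simp [this]
  rw [h1, ContinuousMap.smul_apply, ContinuousMap.sub_apply, h3, smul_eq_mul]
  have h4 := (abs_le.1 h2).2
  have h5 : s * volterra V G x ≤ s * (normBound L * ‖V‖ * (1 / s ^ 2)) := by gcongr
  have h6 : s * (normBound L * ‖V‖ * (1 / s ^ 2)) = normBound L * ‖V‖ / s := by
    field_simp
  linarith

/-- Both angles start at `0`. If they were ever `π/2` apart, `(y', s y)` and `(y', r y)` would be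
orthogonal, so `y'² + s r y² = 0` and `y = y' = 0` there, which is impossible. -/
theorem abs_pruferAngle_sub_lt {s r : ℝ} (hs : 0 < s) (hr : 0 < r) (q : L2Interval L)
    (x : Icc 0 L) : |pruferAngle s q x - pruferAngle r q x| < Real.pi / 2 := by
  by_contra! hx
  have : PreconnectedSpace (Icc 0 L) := Subtype.preconnectedSpace isPreconnected_Icc
  obtain ⟨t, ht⟩ := intermediate_value_univ (⟨0, left_mem⟩ : Icc 0 L) x
    (f := fun t => |pruferAngle s q t - pruferAngle r q t|) (by fun_prop)
    ⟨by simp [pruferAngle_zero, Real.pi_pos.le, div_nonneg], hx⟩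
  have hcos : Real.cos (pruferAngle s q t - pruferAngle r q t) = 0 := by
    rw [← Real.cos_abs]
    exact (congrArg Real.cos ht).trans Real.cos_pi_div_two
  rw [Real.cos_sub] at hcos
  have a1 := initSlope_eq_mul_cos hs q t
  have a2 := initSlope_eq_mul_cos hr q t
  have b1 := mul_initSolution_eq_mul_sin hs q t
  have b2 := mul_initSolution_eq_mul_sin hr q t
  have hD := pruferRadiusSq_pos hs q t
  rw [pruferRadiusSq_apply] at hD
  have h0 : initSlope 0 1 q t * initSlope 0 1 q t +
      s * initSolution 0 1 q t * (r * initSolution 0 1 q t) = 0 := by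
    rw [b1, b2]
    conv_lhs => enter [1]; rw [a1]; enter [2]; rw [← a1, a2]
    linear_combination √(pruferRadiusSq s q t) * √(pruferRadiusSq r q t) * hcos
  have hy : initSolution 0 1 q t = 0 := by
    by_contra hne
    have : 0 < s * initSolution 0 1 q t * (r * initSolution 0 1 q t) := by
      have : 0 < s * r * initSolution 0 1 q t ^ 2 := by positivity
      linarith
    nlinarith [mul_self_nonneg (initSlope 0 1 q t)]
  have hp : initSlope 0 1 q t = 0 := by
    rw [hy] at h0
    simpa using h0
  rw [hy, hp] at hD
  norm_num at hD

end PruferEstimates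

/-- The factor `q - r` vanishes at `r = q`, so the derivative of `f` does not contribute. -/
theorem ContinuousLinearMap.hasFDerivAt_apply_sub {E F G : Type*} [NormedAddCommGroup E]
    [NormedSpace ℝ E] [NormedAddCommGroup F] [NormedSpace ℝ F] [NormedAddCommGroup G]
    [NormedSpace ℝ G] (B : E →L[ℝ] F →L[ℝ] G) {f : E → F} {q : E}
    (hf : DifferentiableAt ℝ f q) :
    HasFDerivAt (fun r => B (q - r) (f r)) (-B.flip (f q)) q := by
  have h : HasFDerivAt (fun r => B (q - r)) (-B) q := by
    simpa only [map_sub] using B.hasFDerivAt.const_sub (B q)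
  refine (h.clm_apply hf.hasFDerivAt).congr_fderiv ?_
  ext
  simp

/-! ### The angle at `L` as a function of potential and energy, and its level sets. -/

section DirichletSpectrum

variable {L : ℝ}

theorem contDiff_eval {f : L2Interval L → C(Icc 0 L, ℝ)} (hf : ContDiff ℝ 1 f) (x : Icc 0 L) :
    ContDiff ℝ 1 fun q => f q x := by
  have h : ContDiff ℝ 1 fun q => ContinuousMap.evalCLM ℝ x (f q) := by fun_prop
  exact h

variable [hL : Fact (0 < L)]

/-- The right end point of `[0, L]`. -/
def rightEnd (L : ℝ) [Fact (0 < L)] : Icc 0 L := ⟨L, right_mem⟩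

/-- The value at `L` of the Prüfer angle of the solution of `y'' = q y`, `y(0) = 0`,
`y'(0) = 1`. -/
noncomputable def totalAngle (q : L2Interval L) : ℝ := pruferAngle 1 q (rightEnd L)

theorem contDiff_totalAngle : ContDiff ℝ 1 (totalAngle (L := L)) := by
  exact contDiff_eval (contDiff_pruferAngle one_pos) _

/-- In Prüfer coordinates Lagrange's identity at `L` reads `√R_r √R_q sin(Θ(r) - Θ(q)) = ∫ (q - r)
y_r y_q`. Differentiate in `r` at `r = q`: the sine vanishes there, so the derivative of the radius
drops out on the left. -/
theorem pruferRadiusSq_mul_fderiv_totalAngle (q h : L2Interval L) :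
    pruferRadiusSq 1 q (rightEnd L) * fderiv ℝ totalAngle q h =
      -volterra h (initSolution 0 1 q * initSolution 0 1 q) (rightEnd L) := by
  set e := rightEnd L with he
  have hid : ∀ r : L2Interval L,
      √(pruferRadiusSq 1 r e) * √(pruferRadiusSq 1 q e) * Real.sin (totalAngle r - totalAngle q) =
        volterra (q - r) (initSolution 0 1 r * initSolution 0 1 q) e := by
    intro r
    have h1 := DFunLike.congr_fun (lagrange_identity 1 1 r q) e
    rw [← h1, ContinuousMap.sub_apply, ContinuousMap.mul_apply, ContinuousMap.mul_apply,
      initSlope_eq_mul_cos one_pos q e, initSlope_eq_mul_cos one_pos r e,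
      ← one_mul (initSolution 0 1 r e), ← one_mul (initSolution 0 1 q e),
      mul_initSolution_eq_mul_sin one_pos r e, mul_initSolution_eq_mul_sin one_pos q e,
      Real.sin_sub]
    simp only [totalAngle, ← he]
    ring
  have dΘ : HasFDerivAt totalAngle (fderiv ℝ totalAngle q) q :=
    (contDiff_totalAngle.differentiable one_ne_zero q).hasFDerivAt
  have hR := pruferRadiusSq_pos one_pos q e
  have dR : DifferentiableAt ℝ (fun r : L2Interval L =>
      √(pruferRadiusSq 1 r e) * √(pruferRadiusSq 1 q e)) q := by
    have h1 : ContDiff ℝ 1 fun r : L2Interval L => pruferRadiusSq 1 r e :=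
      contDiff_eval (contDiff_pruferRadiusSq 1) e
    exact ((h1.differentiable one_ne_zero q).sqrt hR.ne').mul_const _
  have dl := dR.hasFDerivAt.mul ((dΘ.sub_const (totalAngle q)).sin)
  have dY : DifferentiableAt ℝ (fun r : L2Interval L => initSolution 0 1 r * initSolution 0 1 q) q :=
    ((contDiff_initSolution 0 1).differentiable one_ne_zero q).mul_const _
  have dr : HasFDerivAt (fun r : L2Interval L =>
      volterra (q - r) (initSolution 0 1 r * initSolution 0 1 q) e)
      ((ContinuousMap.evalCLM ℝ e).comp
        (-volterra.flip (initSolution 0 1 q * initSolution 0 1 q))) q :=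
    (ContinuousLinearMap.hasFDerivAt (𝕜 := ℝ) (E := C(Icc 0 L, ℝ)) (F := ℝ)
      (ContinuousMap.evalCLM ℝ e)).comp q
      (ContinuousLinearMap.hasFDerivAt_apply_sub volterra dY)
  have huniq := dl.unique (dr.congr_of_eventuallyEq (Filter.Eventually.of_forall hid))
  have := DFunLike.congr_fun huniq h
  simpa [Real.mul_self_sqrt hR.le] using this

theorem volterra_sq_rightEnd (h : L2Interval L) (y : C(Icc 0 L, ℝ)) :
    volterra h (y * y) (rightEnd L) = ∫ x in Ioo 0 L, intervalExtend y x ^ 2 * h x := by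
  rw [volterra_apply, ← integral_Ioc_eq_integral_Ioo,
    ← intervalIntegral.integral_of_le hL.out.le]
  refine intervalIntegral.integral_congr fun t _ => ?_
  change h t * (intervalExtend y t * intervalExtend y t) = _
  ring

theorem volterra_one_sq_rightEnd (y : C(Icc 0 L, ℝ)) :
    volterra (oneL2 L) (y * y) (rightEnd L) = ∫ x in Ioo 0 L, intervalExtend y x ^ 2 := by
  rw [volterra_one_apply, ← integral_Ioc_eq_integral_Ioo,
    ← intervalIntegral.integral_of_le hL.out.le]
  refine intervalIntegral.integral_congr fun t _ => ?_
  change (intervalExtend y t * intervalExtend y t) = _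
  ring

theorem exists_initSolution_ne_zero (q : L2Interval L) : ∃ x, initSolution 0 1 q x ≠ 0 := by
  by_contra! h
  have h0 : initSolution 0 1 q = 0 := ContinuousMap.ext h
  have h1 := initSlope_eq 0 1 q
  rw [h0, map_zero, add_zero] at h1
  have h2 := h (rightEnd L)
  rw [initSolution, h1, ContinuousMap.add_apply, volterra_one_apply] at h2
  have h3 : ∀ t, intervalExtend (ContinuousMap.const (Icc 0 L) (1 : ℝ)) t = 1 := fun t => rfl
  simp only [h3, ContinuousMap.const_apply, intervalIntegral.integral_const, sub_zero, zero_add,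
    smul_eq_mul, mul_one] at h2
  exact hL.out.ne' h2

theorem integral_initSolution_sq_pos (q : L2Interval L) :
    0 < ∫ x in Ioo 0 L, intervalExtend (initSolution 0 1 q) x ^ 2 := by
  obtain ⟨x, hx⟩ := exists_initSolution_ne_zero q
  rw [← integral_Ioc_eq_integral_Ioo, ← intervalIntegral.integral_of_le hL.out.le]
  refine intervalIntegral.integral_pos hL.out
    ((continuous_intervalExtend _).pow 2).continuousOn (fun _ _ => sq_nonneg _)
    ⟨x, x.2, ?_⟩
  rw [intervalExtend_coe]
  positivity

theorem fderiv_totalAngle_one_neg (q : L2Interval L) : fderiv ℝ totalAngle q (oneL2 L) < 0 := by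
  have h := pruferRadiusSq_mul_fderiv_totalAngle q (oneL2 L)
  rw [volterra_one_sq_rightEnd] at h
  have := integral_initSolution_sq_pos q
  have := pruferRadiusSq_pos one_pos q (rightEnd L)
  by_contra! hc
  have := mul_nonneg this.le hc
  linarith

theorem hasDerivAt_totalAngle_sub_smul (V : L2Interval L) (E : ℝ) :
    HasDerivAt (fun E : ℝ => totalAngle (V - E • oneL2 L))
      (-fderiv ℝ totalAngle (V - E • oneL2 L) (oneL2 L)) E := by
  have h1 : HasDerivAt (fun E : ℝ => V - E • oneL2 L) (-oneL2 L) E := by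
    simpa using ((hasDerivAt_id E).smul_const (oneL2 L)).const_sub V
  have h2 := (contDiff_totalAngle.differentiable one_ne_zero (V - E • oneL2 L)).hasFDerivAt
  exact (h2.comp_hasDerivAt E h1).congr_deriv (map_neg _ _)

theorem strictMono_totalAngle_sub_smul (V : L2Interval L) :
    StrictMono fun E : ℝ => totalAngle (V - E • oneL2 L) :=
  strictMono_of_deriv_pos fun E => by
    rw [(hasDerivAt_totalAngle_sub_smul V E).deriv]
    have := fderiv_totalAngle_one_neg (V - E • oneL2 L)
    linarith

/-- The angle is nonnegative for the potential `q + 1` and strictly larger for `q`. Positivity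
excludes the levels `mπ` with `m ≤ 0`. -/
theorem totalAngle_pos (q : L2Interval L) : 0 < totalAngle q := by
  have h := strictMono_totalAngle_sub_smul q (show (-1 : ℝ) < 0 by norm_num)
  simp only [zero_smul, sub_zero] at h
  exact (pruferAngle_nonneg one_pos _ _).trans_lt h

theorem exists_totalAngle_lt_pi (V : L2Interval L) :
    ∃ E : ℝ, totalAngle (V - E • oneL2 L) < Real.pi := by
  have hB : 0 ≤ normBound L * ‖V‖ := mul_nonneg normBound_nonneg (norm_nonneg _)
  set s := normBound L * ‖V‖ + 1 with hs
  have hs0 : 0 < s := by positivity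
  have hpi := Real.pi_gt_three
  have h1 : normBound L * ‖V‖ / s < 1 := (div_lt_one hs0).2 (by linarith)
  refine ⟨-s ^ 2, ?_⟩
  rw [neg_smul, sub_neg_eq_add]
  set q := V + s ^ 2 • oneL2 L with hq
  by_contra! hc
  have h2 := pruferAngle_add_le hs0 V (by linarith) (rightEnd L)
  have h3 := abs_lt.1 (abs_pruferAngle_sub_lt one_pos hs0 q (rightEnd L))
  rw [← hq] at h2
  simp only [totalAngle] at hc
  -- Comparing scales alone gives only `π/4 + 1 + π/2`, which exceeds `π`. The sign of `y(L)`
  -- decides: the angle at scale `s` makes it positive, while an angle at scale `1` between `π` and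
  -- `2π` would make it nonpositive.
  have h4 : 0 < Real.sin (pruferAngle s q (rightEnd L)) :=
    Real.sin_pos_of_pos_of_lt_pi (by linarith) (by linarith)
  have h5 : 0 ≤ Real.sin (pruferAngle 1 q (rightEnd L) - Real.pi) :=
    Real.sin_nonneg_of_nonneg_of_le_pi (by linarith) (by linarith)
  rw [Real.sin_sub_pi] at h5
  have h6 := mul_initSolution_eq_mul_sin one_pos q (rightEnd L)
  have h7 := mul_initSolution_eq_mul_sin hs0 q (rightEnd L)
  have h8 := mul_pos (Real.sqrt_pos.2 (pruferRadiusSq_pos hs0 q (rightEnd L))) h4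
  rw [← h7] at h8
  have h9 := pos_of_mul_pos_right h8 hs0.le
  have h10 := mul_nonneg (Real.sqrt_nonneg (pruferRadiusSq 1 q (rightEnd L))) h5
  linarith

theorem exists_le_totalAngle (V : L2Interval L) (M : ℝ) :
    ∃ E : ℝ, M ≤ totalAngle (V - E • oneL2 L) := by
  have hB : 0 ≤ normBound L * ‖V‖ := mul_nonneg normBound_nonneg (norm_nonneg _)
  have hL0 := hL.out
  -- Then `s * L` covers `|M|`, the error `normBound L * ‖V‖ / s ≤ 1`, and the loss `π/2` in passing
  -- to scale `1`.
  set s := normBound L * ‖V‖ + 1 + (|M| + 1 + Real.pi / 2) / L with hs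
  have hs0 : 0 < s := by positivity
  have h0 : (|M| + 1 + Real.pi / 2) / L ≤ s := by linarith
  have h00 : normBound L * ‖V‖ ≤ s := by
    have : 0 ≤ (|M| + 1 + Real.pi / 2) / L := by positivity
    linarith
  have h1 : normBound L * ‖V‖ / s ≤ 1 := (div_le_one hs0).2 h00
  rw [div_le_iff₀ hL0] at h0
  refine ⟨s ^ 2, ?_⟩
  have h2 : s * L - normBound L * ‖V‖ / s ≤ _ := le_pruferAngle_sub hs0 V (rightEnd L)
  have h3 := abs_lt.1 (abs_pruferAngle_sub_lt one_pos hs0 (V - s ^ 2 • oneL2 L) (rightEnd L))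
  have h4 := le_abs_self M
  simp only [totalAngle]
  linarith

theorem exists_totalAngle_eq (V : L2Interval L) {k : ℕ} (hk : 1 ≤ k) :
    ∃ E : ℝ, totalAngle (V - E • oneL2 L) = k * Real.pi := by
  obtain ⟨a, ha⟩ := exists_totalAngle_lt_pi V
  obtain ⟨b, hb⟩ := exists_le_totalAngle V (k * Real.pi)
  have hk' : (1 : ℝ) ≤ k := by exact_mod_cast hk
  have hc : Continuous fun E : ℝ => totalAngle (V - E • oneL2 L) :=
    contDiff_totalAngle.continuous.comp (by fun_prop)
  exact intermediate_value_univ a b hc ⟨by nlinarith [Real.pi_pos], hb⟩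

/-- The number `E` at which the Prüfer angle at `L` for the potential `V - E` is `k π`. -/
noncomputable def angleEigenvalue {k : ℕ} (hk : 1 ≤ k) (V : L2Interval L) : ℝ :=
  (exists_totalAngle_eq V hk).choose

theorem totalAngle_angleEigenvalue {k : ℕ} (hk : 1 ≤ k) (V : L2Interval L) :
    totalAngle (V - angleEigenvalue hk V • oneL2 L) = k * Real.pi :=
  (exists_totalAngle_eq V hk).choose_spec

theorem eq_angleEigenvalue {k : ℕ} (hk : 1 ≤ k) {V : L2Interval L} {E : ℝ}
    (h : totalAngle (V - E • oneL2 L) = k * Real.pi) : E = angleEigenvalue hk V :=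
  (strictMono_totalAngle_sub_smul V).injective (h.trans (totalAngle_angleEigenvalue hk V).symm)

/-- Implicit function theorem for `Θ(V - E) = kπ`, whose partial derivative in `E` is positive. The
local solution agrees with the global one because the root in `E` is unique. -/
theorem contDiff_angleEigenvalue {k : ℕ} (hk : 1 ≤ k) :
    ContDiff ℝ 1 (angleEigenvalue (L := L) hk) := by
  rw [contDiff_iff_contDiffAt]
  intro V
  set F : L2Interval L × ℝ → ℝ := fun u => totalAngle (u.1 - u.2 • oneL2 L) with hF
  have cF : ContDiff ℝ 1 F :=
    contDiff_totalAngle.comp (contDiff_fst.sub (contDiff_snd.smul contDiff_const))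
  set u : L2Interval L × ℝ := (V, angleEigenvalue hk V) with hu
  have hpartial : fderiv ℝ F u ∘L .inr ℝ (L2Interval L) ℝ =
      ContinuousLinearMap.toSpanSingleton ℝ
        (-fderiv ℝ totalAngle (V - angleEigenvalue hk V • oneL2 L) (oneL2 L)) := by
    have h1 := (hasDerivAt_totalAngle_sub_smul V (angleEigenvalue hk V)).hasFDerivAt
    have h2 : HasFDerivAt (fun E : ℝ => ((V, E) : L2Interval L × ℝ)) (.inr ℝ (L2Interval L) ℝ)
        (angleEigenvalue hk V) := hasFDerivAt_prodMk_right V (angleEigenvalue hk V)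
    exact (((cF.differentiable one_ne_zero u).hasFDerivAt.comp (angleEigenvalue hk V) h2).unique h1)
  have hne : -fderiv ℝ totalAngle (V - angleEigenvalue hk V • oneL2 L) (oneL2 L) ≠ 0 := by
    have := fderiv_totalAngle_one_neg (V - angleEigenvalue hk V • oneL2 L)
    linarith
  have hinv : (fderiv ℝ F u ∘L .inr ℝ (L2Interval L) ℝ).IsInvertible := by
    rw [hpartial]
    refine ⟨ContinuousLinearEquiv.unitsEquivAut ℝ (Units.mk0 _ hne), ?_⟩
    ext
    simp
  have cFu : ContDiffAt ℝ 1 F u := cF.contDiffAt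
  refine (cFu.contDiffAt_implicitFunction one_ne_zero hinv).congr_of_eventuallyEq ?_
  filter_upwards [cFu.eventually_apply_implicitFunction one_ne_zero hinv] with W hW
  refine (eq_angleEigenvalue hk ?_).symm
  exact hW.trans (totalAngle_angleEigenvalue hk V)

/-- Since `W ↦ Θ(W - E(W))` is constant, `dΘ(h) = dE(h) dΘ(1)`; multiply by the squared radius at
`L`. -/
theorem fderiv_angleEigenvalue {k : ℕ} (hk : 1 ≤ k) (V h : L2Interval L) :
    fderiv ℝ (angleEigenvalue hk) V h *
      ∫ x in Ioo 0 L,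
        intervalExtend (initSolution 0 1 (V - angleEigenvalue hk V • oneL2 L)) x ^ 2 =
    ∫ x in Ioo 0 L,
      intervalExtend (initSolution 0 1 (V - angleEigenvalue hk V • oneL2 L)) x ^ 2 * h x := by
  set q := V - angleEigenvalue hk V • oneL2 L with hq
  have h1 : HasFDerivAt (angleEigenvalue hk) (fderiv ℝ (angleEigenvalue hk) V) V :=
    ((contDiff_angleEigenvalue hk).differentiable one_ne_zero V).hasFDerivAt
  have h2 := (hasFDerivAt_id V).sub (h1.smul_const (oneL2 L))
  have h3 := (contDiff_totalAngle.differentiable one_ne_zero q).hasFDerivAt.comp V h2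
  have h4 := h3.unique ((hasFDerivAt_const (k * Real.pi) V).congr_of_eventuallyEq
    (Filter.Eventually.of_forall fun W => totalAngle_angleEigenvalue hk W))
  have h5 := DFunLike.congr_fun h4 h
  have h6 : fderiv ℝ totalAngle q h =
      fderiv ℝ (angleEigenvalue hk) V h * fderiv ℝ totalAngle q (oneL2 L) := by
    simpa [sub_eq_zero] using h5
  have h7 := pruferRadiusSq_mul_fderiv_totalAngle q h
  have h8 := pruferRadiusSq_mul_fderiv_totalAngle q (oneL2 L)
  rw [volterra_one_sq_rightEnd] at h8
  rw [volterra_sq_rightEnd] at h7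
  linear_combination -h7 - fderiv ℝ (angleEigenvalue hk) V h * (-h8) +
    pruferRadiusSq 1 q (rightEnd L) * h6

end DirichletSpectrum

theorem AbsolutelyContinuousOnInterval.of_eq_const_add {f g : ℝ → ℝ} {a b c : ℝ}
    (hg : AbsolutelyContinuousOnInterval g a b) (h : ∀ x ∈ uIcc a b, f x = c + g x) :
    AbsolutelyContinuousOnInterval f a b := by
  rw [absolutelyContinuousOnInterval_iff] at hg ⊢
  intro ε hε
  obtain ⟨δ, hδ, H⟩ := hg ε hε
  refine ⟨δ, hδ, fun E hE hlt => lt_of_eq_of_lt (Finset.sum_congr rfl fun i hi => ?_)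
    (H E hE hlt)⟩
  rw [h _ (hE.1 i hi).1, h _ (hE.1 i hi).2, dist_add_left]

/-! ### Identification of the roots with the Dirichlet eigenvalues. -/

section Eigenfunctions

variable {L : ℝ}

theorem coeFn_sub_smul_one (V : L2Interval L) (E : ℝ) :
    ∀ᵐ t ∂(volume.restrict (Ioo 0 L)), (V - E • oneL2 L) t = V t - E := by
  filter_upwards [Lp.coeFn_sub V (E • oneL2 L), Lp.coeFn_smul E (oneL2 L),
    coeFn_oneL2 (L := L)] with t h1 h2 h3
  rw [h1, Pi.sub_apply, h2, Pi.smul_apply, h3, smul_eq_mul, mul_one]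

variable [hL : Fact (0 < L)]

theorem firstDeriv_initSolution (q : L2Interval L) {x : ℝ} (hx : x ∈ Icc 0 L) :
    firstDeriv L (intervalExtend (initSolution 0 1 q)) x =
      1 + ∫ t in 0..x, q t * intervalExtend (initSolution 0 1 q) t := by
  rw [firstDeriv, (hasDerivWithinAt_initSolution 0 1 q hx).derivWithin
    (uniqueDiffOn_Icc hL.out x hx), intervalExtend_of_mem _ hx]
  conv_lhs => rw [initSlope_eq]
  rfl

theorem secondDeriv_initSolution (q : L2Interval L) :
    ∀ᵐ x ∂(volume.restrict (Ioo 0 L)),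
      secondDeriv L (intervalExtend (initSolution 0 1 q)) x =
        q x * intervalExtend (initSolution 0 1 q) x := by
  have hI := intervalIntegrable_mul_of_L2 q (continuous_intervalExtend (initSolution 0 1 q))
    left_mem right_mem
  rw [ae_restrict_iff' measurableSet_Ioo]
  filter_upwards [hI.ae_hasDerivAt_integral] with x hx hxI
  have hd := hx (by rw [uIcc_of_le hL.out.le]; exact Ioo_subset_Icc_self hxI) 0 left_mem_uIcc
  refine ((hd.const_add 1).congr_of_eventuallyEq ?_).deriv
  filter_upwards [Icc_mem_nhds hxI.1 hxI.2] with t ht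
  exact firstDeriv_initSolution q ht

theorem isDirichletEigenfunction_initSolution {V : L2Interval L} {E : ℝ}
    (h : initSolution 0 1 (V - E • oneL2 L) (rightEnd L) = 0) :
    IsDirichletEigenfunction L V E (intervalExtend (initSolution 0 1 (V - E • oneL2 L))) := by
  set q := V - E • oneL2 L with hq
  have hY := continuous_intervalExtend (initSolution 0 1 q)
  refine ⟨⟨fun x hx => (hasDerivWithinAt_initSolution 0 1 q hx).differentiableWithinAt, ?_, ?_,
    ?_, ?_⟩, ?_, ?_⟩
  · refine ((intervalIntegrable_mul_of_L2 q hY left_mem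
      right_mem).absolutelyContinuousOnInterval_intervalIntegral left_mem_uIcc).of_eq_const_add
      (c := 1) fun x hx => ?_
    rw [uIcc_of_le hL.out.le] at hx
    exact firstDeriv_initSolution q hx
  · refine MemLp.ae_eq (Filter.EventuallyEq.symm (secondDeriv_initSolution q)) ?_
    refine (Lp.memLp q).of_le_mul (c := ‖initSolution 0 1 q‖)
      ((Lp.memLp q).aestronglyMeasurable.mul hY.aestronglyMeasurable)
      (Filter.Eventually.of_forall fun t => ?_)
    rw [norm_mul, mul_comm]
    exact mul_le_mul_of_nonneg_right (abs_intervalExtend_le _ t) (norm_nonneg _)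
  · rw [intervalExtend_of_mem _ left_mem, initSolution_zero]
  · rw [intervalExtend_of_mem _ right_mem]
    exact h
  · obtain ⟨x, hx⟩ := exists_initSolution_ne_zero q
    exact ⟨x, x.2, by rwa [intervalExtend_coe]⟩
  · filter_upwards [secondDeriv_initSolution q, coeFn_sub_smul_one V E] with x h1 h2
    rw [h1, hq, h2]
    ring

theorem smul_initSlope (c : ℝ) (q : L2Interval L) :
    c • initSlope 0 1 q = initSlope 0 c q := by
  refine eq_initSlope ?_
  have h0 : ContinuousMap.const (Icc 0 L) (0 : ℝ) = 0 := rfl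
  have hc : ContinuousMap.const (Icc 0 L) c = c • ContinuousMap.const (Icc 0 L) (1 : ℝ) := by
    ext
    simp
  conv_lhs => rw [initSlope_eq, initSolution]
  rw [h0, zero_add, zero_add, hc, smul_add, map_smul, map_smul]

/-- Absolute continuity of `φ'` allows the equation to be integrated, so `φ'` solves the Volterra
equation with initial slope `φ'(0)`. Uniqueness (`eq_initSlope`) gives `c = φ'(0)`, which is nonzero
because `φ` is. -/
theorem IsDirichletEigenfunction.exists_eq_mul_initSolution {V : L2Interval L} {E : ℝ}
    {φ : ℝ → ℝ} (h : IsDirichletEigenfunction L V E φ) :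
    ∃ c : ℝ, c ≠ 0 ∧ ∀ x ∈ Icc 0 L,
      φ x = c * intervalExtend (initSolution 0 1 (V - E • oneL2 L)) x := by
  set q := V - E • oneL2 L with hq
  obtain ⟨⟨hdiff, hac, -, h0, -⟩, hne, heq⟩ := h
  have hcont : ContinuousOn (firstDeriv L φ) (Icc 0 L) := by
    have := hac.continuousOn
    rwa [uIcc_of_le hL.out.le] at this
  set p : C(Icc 0 L, ℝ) := ⟨fun x => firstDeriv L φ x, hcont.domRestrict⟩ with hp
  have hpx : ∀ x ∈ Icc 0 L, intervalExtend p x = firstDeriv L φ x := fun x hx =>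
    intervalExtend_of_mem p hx
  have hφ : ∀ x ∈ Icc 0 L, φ x = ∫ t in 0..x, intervalExtend p t := by
    intro x hx
    rw [intervalIntegral.integral_eq_sub_of_hasDerivAt_of_le (f := φ) hx.1
      (hdiff.continuousOn.mono (Icc_subset_Icc_right hx.2)) (fun t ht => ?_)
      ((continuous_intervalExtend p).intervalIntegrable _ _), h0, sub_zero]
    have ht' : t ∈ Ioo 0 L := ⟨ht.1, ht.2.trans_le hx.2⟩
    rw [hpx t (Ioo_subset_Icc_self ht')]
    exact (hdiff t (Ioo_subset_Icc_self ht')).hasDerivWithinAt.hasDerivAt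
      (Icc_mem_nhds ht'.1 ht'.2)
  have hφ' : ∀ x : Icc 0 L, φ x = volterra (oneL2 L) p x := fun x => by
    rw [hφ x x.2, volterra_one_apply]
  have hpe : p = initSlope 0 (firstDeriv L φ 0) q := by
    refine eq_initSlope ?_
    ext x
    have hz : ContinuousMap.const (Icc 0 L) (0 : ℝ) = 0 := rfl
    rw [hz, zero_add, ContinuousMap.add_apply, ContinuousMap.const_apply, volterra_apply,
      ← sub_eq_iff_eq_add']
    have hx := x.2
    have hsub : uIcc 0 (x : ℝ) ⊆ uIcc 0 L := by
      rw [uIcc_of_le hL.out.le]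
      exact uIcc_subset_Icc left_mem hx
    change firstDeriv L φ x - _ = _
    rw [← (hac.mono hsub).integral_deriv_eq_sub]
    refine intervalIntegral_congr_of_ae_Ioo ?_ left_mem hx
    filter_upwards [heq, coeFn_sub_smul_one V E, ae_restrict_mem measurableSet_Ioo]
      with t h1 h2 ht
    have ht' := Ioo_subset_Icc_self ht
    rw [h2, intervalExtend_of_mem _ ht', ← hφ' ⟨t, ht'⟩]
    change secondDeriv L φ t = (V t - E) * φ t
    linarith
  have hsol : ∀ x ∈ Icc 0 L,
      φ x = firstDeriv L φ 0 * intervalExtend (initSolution 0 1 q) x := fun x hx => by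
    rw [hφ' ⟨x, hx⟩, hpe, ← smul_initSlope, map_smul, intervalExtend_of_mem _ hx, initSolution]
    simp
  refine ⟨firstDeriv L φ 0, fun hc => ?_, hsol⟩
  obtain ⟨x, hx, hxne⟩ := hne
  rw [hsol x hx, hc, zero_mul] at hxne
  exact hxne rfl

theorem mem_dirichletEigenvalues_iff_initSolution {V : L2Interval L} {E : ℝ} :
    E ∈ dirichletEigenvalues L V ↔ initSolution 0 1 (V - E • oneL2 L) (rightEnd L) = 0 := by
  refine ⟨?_, fun h => ⟨_, isDirichletEigenfunction_initSolution h⟩⟩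
  rintro ⟨φ, hφ⟩
  obtain ⟨c, hc, h⟩ := hφ.exists_eq_mul_initSolution
  have h1 := h L right_mem
  rw [hφ.mem_domain.right_eq_zero, intervalExtend_of_mem _ right_mem] at h1
  exact (mul_eq_zero.1 h1.symm).resolve_left hc

/-- `y(L) = 0` means `Θ = mπ` for an integer `m`, and `Θ > 0` forces `m ≥ 1`; hence the shift from
`n` to `n + 1`. -/
theorem mem_dirichletEigenvalues_iff {V : L2Interval L} {E : ℝ} :
    E ∈ dirichletEigenvalues L V ↔ ∃ n : ℕ, angleEigenvalue n.succ_pos V = E := by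
  rw [mem_dirichletEigenvalues_iff_initSolution, initSolution_eq_zero_iff_sin one_pos,
    Real.sin_eq_zero_iff]
  constructor
  · rintro ⟨m, hm⟩
    have hpos := totalAngle_pos (V - E • oneL2 L)
    rw [totalAngle, ← hm] at hpos
    have hm0 : 0 < m := by exact_mod_cast pos_of_mul_pos_left hpos Real.pi_pos.le
    obtain ⟨n, hn⟩ := Int.eq_succ_of_zero_lt hm0
    refine ⟨n, (eq_angleEigenvalue _ ?_).symm⟩
    rw [totalAngle, ← hm, hn]
    push_cast
    ring
  · rintro ⟨n, rfl⟩
    exact ⟨n.succ, (totalAngle_angleEigenvalue n.succ_pos V).symm⟩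

theorem strictMono_angleEigenvalue (V : L2Interval L) :
    StrictMono fun n : ℕ => angleEigenvalue n.succ_pos V := by
  intro m n hmn
  rw [← (strictMono_totalAngle_sub_smul V).lt_iff_lt]
  simp only [totalAngle_angleEigenvalue]
  have : (m.succ : ℝ) < n.succ := by exact_mod_cast Nat.succ_lt_succ hmn
  exact mul_lt_mul_of_pos_right this Real.pi_pos

theorem encard_dirichletEigenvalues_inter_Iic (V : L2Interval L) (n : ℕ) :
    (dirichletEigenvalues L V ∩ Iic (angleEigenvalue n.succ_pos V)).encard = (n + 1 : ℕ) := by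
  have h : dirichletEigenvalues L V ∩ Iic (angleEigenvalue n.succ_pos V) =
      (fun n : ℕ => angleEigenvalue n.succ_pos V) '' (Finset.range (n + 1) : Set ℕ) := by
    ext E
    simp only [mem_inter_iff, mem_dirichletEigenvalues_iff, mem_Iic, mem_image, Finset.mem_coe,
      Finset.mem_range, Nat.lt_succ_iff]
    constructor
    · rintro ⟨⟨m, rfl⟩, hm⟩
      exact ⟨m, (strictMono_angleEigenvalue V).le_iff_le.1 hm, rfl⟩
    · rintro ⟨m, hm, rfl⟩
      exact ⟨⟨m, rfl⟩, (strictMono_angleEigenvalue V).le_iff_le.2 hm⟩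
  rw [h, (strictMono_angleEigenvalue V).injective.encard_image, Set.encard_coe_eq_coe_finsetCard,
    Finset.card_range]

theorem isKthDirichletEigenvalue_iff {k : ℕ} (hk : 1 ≤ k) (V : L2Interval L) {E : ℝ} :
    IsKthDirichletEigenvalue L k V E ↔ E = angleEigenvalue hk V := by
  obtain ⟨n, rfl⟩ : ∃ n, k = n + 1 := ⟨k - 1, by omega⟩
  constructor
  · rintro ⟨h1, h2⟩
    obtain ⟨m, rfl⟩ := mem_dirichletEigenvalues_iff.1 h1
    rw [encard_dirichletEigenvalues_inter_Iic] at h2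
    obtain rfl : m = n := by
      have : m + 1 = n + 1 := by exact_mod_cast h2
      omega
    rfl
  · rintro rfl
    exact ⟨mem_dirichletEigenvalues_iff.2 ⟨n, rfl⟩, encard_dirichletEigenvalues_inter_Iic V n⟩

theorem dirichletEigenvalue_eq {k : ℕ} (hk : 1 ≤ k) (V : L2Interval L) :
    dirichletEigenvalue L k V = angleEigenvalue hk V := by
  have : {E | IsKthDirichletEigenvalue L k V E} = {angleEigenvalue hk V} := by
    ext E
    exact isKthDirichletEigenvalue_iff hk V
  rw [dirichletEigenvalue, this, csInf_singleton]

end Eigenfunctions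

/-- For `k ≥ 1` the `k`-th Dirichlet eigenvalue exists for every potential in `L²(0, L)`, is a
continuously Fréchet differentiable function of the potential, and its derivative at `V` is
`h ↦ ⟨φ², h⟩ / ‖φ‖²` for each eigenfunction `φ` for the eigenvalue `E_k(V)`. -/
theorem lemma1 (L : ℝ) (hL : 0 < L) (k : ℕ) (hk : 1 ≤ k) :
    (∀ V : L2Interval L, IsKthDirichletEigenvalue L k V (dirichletEigenvalue L k V)) ∧
    ContDiff ℝ 1 (fun V : L2Interval L => dirichletEigenvalue L k V) ∧
    ∀ (V : L2Interval L) (φ : ℝ → ℝ),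
      IsDirichletEigenfunction L V (dirichletEigenvalue L k V) φ →
      ∀ h : L2Interval L,
        fderiv ℝ (fun W : L2Interval L => dirichletEigenvalue L k W) V h =
          (1 / ∫ x in Ioo 0 L, φ x ^ 2) * ∫ x in Ioo 0 L, φ x ^ 2 * h x := by
  have : Fact (0 < L) := ⟨hL⟩
  have hfun : (fun V : L2Interval L => dirichletEigenvalue L k V) = angleEigenvalue hk :=
    funext (dirichletEigenvalue_eq hk)
  refine ⟨fun V => (isKthDirichletEigenvalue_iff hk V).2 (dirichletEigenvalue_eq hk V),
    hfun ▸ contDiff_angleEigenvalue hk, fun V φ hφ h => ?_⟩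
  rw [dirichletEigenvalue_eq hk] at hφ
  -- The formula is homogeneous of degree zero in `φ`, so the factor `c²` cancels and `y` may
  -- replace `φ`.
  obtain ⟨c, hc, hφc⟩ := hφ.exists_eq_mul_initSolution
  set y := intervalExtend (initSolution 0 1 (V - angleEigenvalue hk V • oneL2 L)) with hy
  have h1 : ∫ x in Ioo 0 L, φ x ^ 2 = c ^ 2 * ∫ x in Ioo 0 L, y x ^ 2 := by
    rw [← integral_const_mul]
    refine setIntegral_congr_fun measurableSet_Ioo fun x hx => ?_
    rw [hφc x (Ioo_subset_Icc_self hx), mul_pow]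
  have h2 : ∫ x in Ioo 0 L, φ x ^ 2 * h x = c ^ 2 * ∫ x in Ioo 0 L, y x ^ 2 * h x := by
    rw [← integral_const_mul]
    refine setIntegral_congr_fun measurableSet_Ioo fun x hx => ?_
    rw [hφc x (Ioo_subset_Icc_self hx), mul_pow, mul_assoc]
  have hpos := integral_initSolution_sq_pos (V - angleEigenvalue hk V • oneL2 L)
  rw [← hy] at hpos
  have hne := hpos.ne'
  rw [hfun, h1, h2, ← fderiv_angleEigenvalue hk V h, ← hy]
  field_simp
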